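/- **Notation and definitions.** Let $\mathbb F$ be a field of characteristic different from $2$. A matrix polynomial $Q(\lambda)=\sum_{j=0}^{g}\lambda^jQ_j$ over $\mathbb F$ is considered together with a grade $g$ (leading coefficients may be zero). Let $\star$ denote either transposition or, when $\mathbb F=\mathbb C$, conjugate transposition; more generally, $\star$ may be transposition combined with the entrywise application of a field automorphism $\sigma$ of $\mathbb F$ with $\sigma^2=\mathrm{id}$. Put $Q^\star(\lambda)=\sum_j\lambda^jQ_j^\star$. The $g$-reversal is $\mathrm{rev}_gQ(\lambda)=\sum_{j=0}^g\lambda^jQ_{g-j}$, and for an invertible $A=\begin{bmatrix}a&b\\c&e\end{bmatrix}$ the Möbius transformation of $Q$, of grade $g$, is $$\mathbb M_A[Q](\lambda)=\sum_{j=0}^{g}Q_j\,(a\lambda+b)^j(c\lambda+e)^{g-j}.$$ Let $A_1=\begin{bmatrix}1&0\\0&1\end{bmatrix}$, $A_2=\begin{bmatrix}-1&0\\0&1\end{bmatrix}$, $A_3=\begin{bmatrix}0&1\\1&0\end{bmatrix}$. For a sign $\varepsilon\in\{1,-1\}$, a square $Q$ is *$\mathbb M_A$-structured with sign $\varepsilon$*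 if $\mathbb M_A[\varepsilon Q]=Q^\star$. For $(A,\varepsilon)=(A_1,1),(A_1,-1),(A_2,1),(A_2,-1),(A_3,1),(A_3,-1)$ this means that $Q$ is, respectively, $\star$-symmetric, $\star$-skew-symmetric, $\star$-even, $\star$-odd, $\star$-palindromic, $\star$-anti-palindromic. A square matrix polynomial is *unimodular* if its determinant is a nonzero constant. A square $L$ of grade $\ell$ is an *$\ell$-ification* of a square $P$ of grade $k$ if $U L V=\begin{bmatrix}I_s&0\\0&P\end{bmatrix}$ for some $s\ge0$ and unimodular $U,V$; it is a *strong $\ell$-ification* if, in addition, $\mathrm{rev}_\ell L$ is an $\ell$-ification of $\mathrm{rev}_kP$. The *right* (resp. *left*) *minimal indices* of $P$ are the degrees, in non-decreasing order, of the vectors in a basis of $\{x: Px=0\}$ (resp. $\{y: y^\top P=0\}$) over $\mathbb F(\lambda)$ that consists of polynomial vectors and has the least possible sum of degrees, the degree of a polynomial vector being the largest degree of its entries. Let $n\ge0$, $d\ge0$, $\ell\ge1$ be integers and $k=(2d+1)\ell$. Let $L_d(\lambda)$ be the $d\times(d+1)$ pencil with entries $-1$ in the positions $(i,i)$, $\lambda$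 in the positions $(i,i+1)$, and $0$ elsewhere. Write $\mathbb M_A[\varepsilon L_d](\lambda^\ell)$ for the Möbius transformation of $\varepsilon L_d(\lambda^\ell)$ as a matrix polynomial of grade $\ell$. An *$\mathbb M_A$-structured block-Kronecker matrix polynomial of grade $\ell$ with sign $\varepsilon$* is one of the form $$\begin{bmatrix}N(\lambda)&\mathbb M_A[\varepsilon L_d]^\top(\lambda^\ell)\otimes I_n\\ L_d(\lambda^\ell)\otimes I_n&0\end{bmatrix},\qquad N\text{ of grade }\ell,\quad \mathbb M_A[\varepsilon N]=N^\star .$$ Let $P(\lambda)=\sum_{j=0}^k\lambda^jP_j\in\mathbb F[\lambda]^{n\times n}$ have grade $k$, let $M(\lambda)=\sum_{i=0}^\ell\lambda^iM_i\in\mathbb F[\lambda]^{(d+1)n\times(d+1)n}$ have grade $\ell$, and let $[M_i]_{s,t}\in\mathbb F^{n\times n}$, $1\le s,t\le d+1$, be the blocks of $M_i$. In each of the following conditions the first equation is for $r=0,\dots,2d+1$ and the second for $r=0,\dots,2d$ and $c=1,\dots,\ell-1$. * **AS condition:** $P_{\ell r}=\sum_{s+t=2d+2-r}[M_0]_{s,t}+\sum_{s+t=2d+3-r}[M_\ell]_{s,t}$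 and $P_{\ell r+c}=\sum_{s+t=2d+2-r}[M_c]_{s,t}$. * **ASS condition:** $P_{\ell r}=\sum_{s+t=2d+2-r}(-1)^{d-s+1}[M_0]_{s,t}+\sum_{s+t=2d+3-r}(-1)^{d-s+1}[M_\ell]_{s,t}$ and $P_{\ell r+c}=\sum_{s+t=2d+2-r}(-1)^{d-s+1}[M_c]_{s,t}$. * **DS condition:** $P_{\ell r}=\sum_{s-t=r-d}[M_0]_{s,t}+\sum_{s-t=r-d-1}[M_\ell]_{s,t}$ and $P_{\ell r+c}=\sum_{s-t=r-d}[M_c]_{s,t}$. **Theorem.** Let $A\in\{A_1,A_2,A_3\}$ and $\varepsilon\in\{1,-1\}$, and let $P$ be $\mathbb M_A$-structured with sign $\varepsilon$, of grade $k=(2d+1)\ell$. Suppose that $M$ satisfies one of the following: 1. the AS condition for $P$, where $A=A_1$ ($\ell$ arbitrary) or $A=A_2$ and $\ell$ is even; 2. the ASS condition for $P$, where $A=A_2$ and $\ell$ is odd; 3. the DS condition for $P$, where $A=A_3$ ($\ell$ arbitrary). Then $$\mathcal L(\lambda)=\begin{bmatrix}\tfrac12\bigl(M+\mathbb M_A[\varepsilon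 M]^\star\bigr)(\lambda)&\mathbb M_A[\varepsilon L_d]^\top(\lambda^\ell)\otimes I_n\\ L_d(\lambda^\ell)\otimes I_n&0\end{bmatrix}$$ is an $\mathbb M_A$-structured block-Kronecker matrix polynomial of grade $\ell$ with sign $\varepsilon$, and $\mathbb M_A[\varepsilon\mathcal L]=\mathcal L^\star$. Moreover, $\mathcal L$ is a strong $\ell$-ification of $P$; if $\epsilon_1\le\dots\le\epsilon_p$ are the right minimal indices of $P$, then the right minimal indices of $\mathcal L$ are $\epsilon_1+d\ell\le\dots\le\epsilon_p+d\ell$; and if $\eta_1\le\dots\le\eta_q$ are the left minimal indices of $P$, then the left minimal indices of $\mathcal L$ are $\eta_1+d\ell\le\dots\le\eta_q+d\ell$. -/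

import Mathlib

open Polynomial
open scoped Kronecker

namespace MatPoly

noncomputable section

variable {F : Type*} [Field F] {m n : Type*}

/-! Matrix polynomials over `F` are matrices with entries in `F[X]`. -/

/-- `P` has grade `k`: `P = ∑_{j ≤ k} λ^j P_j` (leading coefficients may vanish). -/
def HasGrade (k : ℕ) (P : Matrix m n F[X]) : Prop :=
  ∀ i j, (P i j).natDegree ≤ k

/-- The coefficient matrix `P_j`. -/
def coeffMatrix (P : Matrix m n F[X]) (j : ℕ) : Matrix m n F :=
  P.map fun p => p.coeff j

/-- The reversal `rev_k P = ∑_{j ≤ k} λ^j P_{k-j}` of a matrix polynomial of grade `k`. -/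
def rev (k : ℕ) (P : Matrix m n F[X]) : Matrix m n F[X] :=
  P.map (Polynomial.reflect k)

/-- `P^⋆ = ∑_j λ^j P_j^⋆`, where the star of a constant matrix is its transpose with the
automorphism `σ` applied to the entries. For `σ` the identity this is the transpose; for `F = ℂ`
and `σ` the complex conjugation it is the conjugate transpose. -/
def star (σ : F →+* F) (P : Matrix m n F[X]) : Matrix n m F[X] :=
  P.transpose.map (Polynomial.map σ)

/-- The Moebius transformation of a matrix polynomial `P = ∑_{j ≤ k} λ^j P_j` of grade `k` induced
by `A = [a b; c d]`, namely `∑_{j ≤ k} P_j (a λ + b)^j (c λ + d)^(k-j)`. -/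
def moebius (k : ℕ) (A : Matrix (Fin 2) (Fin 2) F) (P : Matrix m n F[X]) : Matrix m n F[X] :=
  P.map fun p => ∑ j ∈ Finset.range (k + 1),
    C (p.coeff j) * (C (A 0 0) * X + C (A 0 1)) ^ j * (C (A 1 0) * X + C (A 1 1)) ^ (k - j)

variable (F) in
/-- The matrix of the (skew-)symmetric structures. -/
def A₁ : Matrix (Fin 2) (Fin 2) F := !![1, 0; 0, 1]

variable (F) in
/-- The matrix of the alternating (even and odd) structures. -/
def A₂ : Matrix (Fin 2) (Fin 2) F := !![-1, 0; 0, 1]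

variable (F) in
/-- The matrix of the (anti-)palindromic structures. -/
def A₃ : Matrix (Fin 2) (Fin 2) F := !![0, 1; 1, 0]

/-- The grade-`k` matrix polynomial `P` satisfies `𝕄_A[ε P] = P^⋆`, for the sign `ε = ±1`. -/
def IsMoebiusStructured (σ : F →+* F) (k : ℕ) (A : Matrix (Fin 2) (Fin 2) F) (ε : F)
    (P : Matrix n n F[X]) : Prop :=
  moebius k A (ε • P) = star σ P

/-! ### Strong `ℓ`-ifications -/

/-- The determinant is a nonzero constant. -/
def IsUnimodular [Fintype m] [DecidableEq m] (U : Matrix m m F[X]) : Prop :=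
  ∃ c : F, c ≠ 0 ∧ U.det = C c

/-- `L`, of grade `ℓ`, is unimodularly equivalent to `diag(I_s, P)` for some `s`, where `P` has
grade `k`. The bijection `e` only names the rows and columns of `diag(I_s, P)` by those of `L`. -/
def IsEllification [Fintype m] [DecidableEq m] [DecidableEq n] (ℓ k : ℕ)
    (L : Matrix m m F[X]) (P : Matrix n n F[X]) : Prop :=
  HasGrade ℓ L ∧ HasGrade k P ∧
    ∃ (s : ℕ) (e : Fin s ⊕ n ≃ m) (U V : Matrix m m F[X]),
      IsUnimodular U ∧ IsUnimodular V ∧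
        U * L * V = (Matrix.fromBlocks 1 0 0 P).reindex e e

/-- `L` is an `ℓ`-ification of `P`, and `rev_ℓ L` is an `ℓ`-ification of `rev_k P`. -/
def IsStrongEllification [Fintype m] [DecidableEq m] [DecidableEq n] (ℓ k : ℕ)
    (L : Matrix m m F[X]) (P : Matrix n n F[X]) : Prop :=
  IsEllification ℓ k L P ∧ IsEllification ℓ k (rev ℓ L) (rev k P)

/-! ### Minimal indices -/

/-- The right nullspace `{x ∈ F(λ)^n : P x = 0}`. -/
def rightNullspace [Fintype n] (P : Matrix m n F[X]) : Submodule (RatFunc F) (n → RatFunc F) :=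
  LinearMap.ker (P.map (algebraMap F[X] (RatFunc F))).mulVecLin

/-- The left nullspace `{y ∈ F(λ)^m : yᵀ P = 0}`. -/
def leftNullspace [Fintype m] (P : Matrix m n F[X]) : Submodule (RatFunc F) (m → RatFunc F) :=
  rightNullspace P.transpose

/-- The degree of a polynomial vector: the largest degree of its entries. -/
def vecDegree [Fintype n] (v : n → F[X]) : ℕ :=
  Finset.univ.sup fun j => (v j).natDegree

/-- The polynomial vectors `v_1, …, v_p` form a basis of the rational subspace `N`. -/
def IsPolynomialBasis (N : Submodule (RatFunc F) (n → RatFunc F)) {p : ℕ}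
    (v : Fin p → n → F[X]) : Prop :=
  LinearIndependent (RatFunc F) (fun i j => algebraMap F[X] (RatFunc F) (v i j)) ∧
    Submodule.span (RatFunc F)
      (Set.range fun (i : Fin p) (j : n) => algebraMap F[X] (RatFunc F) (v i j)) = N

/-- A polynomial basis of `N` whose sum of degrees is least among all polynomial bases of `N`. -/
def IsMinimalBasisOf [Fintype n] (N : Submodule (RatFunc F) (n → RatFunc F)) {p : ℕ}
    (v : Fin p → n → F[X]) : Prop :=
  IsPolynomialBasis N v ∧
    ∀ w : Fin p → n → F[X], IsPolynomialBasis N w →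
      ∑ i, vecDegree (v i) ≤ ∑ i, vecDegree (w i)

/-- `η_1 ≤ ⋯ ≤ η_p` are the degrees of the vectors of a minimal basis of `N`. -/
def AreMinimalIndicesOf [Fintype n] (N : Submodule (RatFunc F) (n → RatFunc F)) {p : ℕ}
    (η : Fin p → ℕ) : Prop :=
  Monotone η ∧ ∃ v : Fin p → n → F[X], IsMinimalBasisOf N v ∧ ∀ i, vecDegree (v i) = η i

/-- `η_1 ≤ ⋯ ≤ η_p` are the right minimal indices of `P`. -/
def AreRightMinimalIndices [Fintype n] (P : Matrix m n F[X]) {p : ℕ} (η : Fin p → ℕ) : Prop :=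
  AreMinimalIndicesOf (rightNullspace P) η

/-- `η_1 ≤ ⋯ ≤ η_p` are the left minimal indices of `P`. -/
def AreLeftMinimalIndices [Fintype m] (P : Matrix m n F[X]) {p : ℕ} (η : Fin p → ℕ) : Prop :=
  AreMinimalIndicesOf (leftNullspace P) η

/-! ### Block-Kronecker matrix polynomials -/

variable (F) in
/-- The `d × (d+1)` pencil `L_d(λ)` with `-1` on the diagonal and `λ` on the superdiagonal. -/
def kroneckerPencil (d : ℕ) : Matrix (Fin d) (Fin (d + 1)) F[X] :=
  Matrix.of fun i j => if j = i.castSucc then -1 else if j = i.succ then X else 0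

variable (F) in
/-- The grade-`ℓ` matrix polynomial `L_d(λ^ℓ)`. -/
def kroneckerPencilPow (d ℓ : ℕ) : Matrix (Fin d) (Fin (d + 1)) F[X] :=
  (kroneckerPencil F d).map (Polynomial.expand F ℓ)

/-- The matrix polynomial `[M, 𝕄_A[ε L_d]ᵀ(λ^ℓ) ⊗ I_n; L_d(λ^ℓ) ⊗ I_n, 0]`. Here the Moebius
transformation is that of `L_d(λ^ℓ)` as a matrix polynomial of grade `ℓ`. -/
def blockKronecker (d ℓ n : ℕ) (A : Matrix (Fin 2) (Fin 2) F) (ε : F)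
    (M : Matrix (Fin (d + 1) × Fin n) (Fin (d + 1) × Fin n) F[X]) :
    Matrix ((Fin (d + 1) × Fin n) ⊕ (Fin d × Fin n))
      ((Fin (d + 1) × Fin n) ⊕ (Fin d × Fin n)) F[X] :=
  Matrix.fromBlocks M
    ((moebius ℓ A (ε • kroneckerPencilPow F d ℓ)).transpose ⊗ₖ (1 : Matrix (Fin n) (Fin n) F[X]))
    (kroneckerPencilPow F d ℓ ⊗ₖ (1 : Matrix (Fin n) (Fin n) F[X]))
    0

/-- `L` is an `𝕄_A`-structured block-Kronecker matrix polynomial of grade `ℓ`, with sign `ε`: it is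
a `blockKronecker` matrix polynomial whose (1,1) block `M`, of grade `ℓ`, satisfies
`𝕄_A[ε M] = M^⋆`. -/
def IsStructuredBlockKronecker (σ : F →+* F) (d ℓ n : ℕ) (A : Matrix (Fin 2) (Fin 2) F) (ε : F)
    (L : Matrix ((Fin (d + 1) × Fin n) ⊕ (Fin d × Fin n))
      ((Fin (d + 1) × Fin n) ⊕ (Fin d × Fin n)) F[X]) : Prop :=
  ∃ M : Matrix (Fin (d + 1) × Fin n) (Fin (d + 1) × Fin n) F[X],
    HasGrade ℓ M ∧ IsMoebiusStructured σ ℓ A ε M ∧ L = blockKronecker d ℓ n A ε M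

/-- `½ (M + 𝕄_A[ε M]^⋆)`, for `M` of grade `ℓ`. -/
def structuredPart (σ : F →+* F) (ℓ : ℕ) (A : Matrix (Fin 2) (Fin 2) F) (ε : F)
    (M : Matrix n n F[X]) : Matrix n n F[X] :=
  (2 : F)⁻¹ • (M + star σ (moebius ℓ A (ε • M)))

/-! ### The anti-diagonal sum, anti-diagonal signed sum and diagonal sum conditions

Block rows and columns `s, t = 1, …, d+1` are indexed by `s, t : Fin (d + 1)`, which start at `0`,
so that the number of a block row is `s + 1`. -/

/-- The `n × n` block `[M_i]_{s+1,t+1}` of the coefficient `M_i`. -/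
def block {d n : ℕ} (M : Matrix (Fin (d + 1) × Fin n) (Fin (d + 1) × Fin n) F[X]) (i : ℕ)
    (s t : Fin (d + 1)) : Matrix (Fin n) (Fin n) F :=
  Matrix.of fun a b => (M (s, a) (t, b)).coeff i

/-- The anti-diagonal sum condition. -/
def AS (ℓ d : ℕ) {n : ℕ} (P : Matrix (Fin n) (Fin n) F[X])
    (M : Matrix (Fin (d + 1) × Fin n) (Fin (d + 1) × Fin n) F[X]) : Prop :=
  (∀ r : ℕ, r ≤ 2 * d + 1 →
    coeffMatrix P (ℓ * r) =
      (∑ s : Fin (d + 1), ∑ t : Fin (d + 1),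
        if ((s : ℤ) + 1) + ((t : ℤ) + 1) = 2 * d + 2 - r then block M 0 s t else 0) +
      ∑ s : Fin (d + 1), ∑ t : Fin (d + 1),
        if ((s : ℤ) + 1) + ((t : ℤ) + 1) = 2 * d + 3 - r then block M ℓ s t else 0) ∧
  (∀ r : ℕ, r ≤ 2 * d → ∀ c : ℕ, 1 ≤ c → c ≤ ℓ - 1 →
    coeffMatrix P (ℓ * r + c) =
      ∑ s : Fin (d + 1), ∑ t : Fin (d + 1),
        if ((s : ℤ) + 1) + ((t : ℤ) + 1) = 2 * d + 2 - r then block M c s t else 0)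

/-- The anti-diagonal signed sum condition. For the block row number `s + 1`, the sign
`(-1)^(d - (s+1) + 1)` is `(-1)^(d - s)`, where `s ≤ d`. -/
def ASS (ℓ d : ℕ) {n : ℕ} (P : Matrix (Fin n) (Fin n) F[X])
    (M : Matrix (Fin (d + 1) × Fin n) (Fin (d + 1) × Fin n) F[X]) : Prop :=
  (∀ r : ℕ, r ≤ 2 * d + 1 →
    coeffMatrix P (ℓ * r) =
      (∑ s : Fin (d + 1), ∑ t : Fin (d + 1),
        if ((s : ℤ) + 1) + ((t : ℤ) + 1) = 2 * d + 2 - r then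
          (-1 : F) ^ (d - (s : ℕ)) • block M 0 s t else 0) +
      ∑ s : Fin (d + 1), ∑ t : Fin (d + 1),
        if ((s : ℤ) + 1) + ((t : ℤ) + 1) = 2 * d + 3 - r then
          (-1 : F) ^ (d - (s : ℕ)) • block M ℓ s t else 0) ∧
  (∀ r : ℕ, r ≤ 2 * d → ∀ c : ℕ, 1 ≤ c → c ≤ ℓ - 1 →
    coeffMatrix P (ℓ * r + c) =
      ∑ s : Fin (d + 1), ∑ t : Fin (d + 1),
        if ((s : ℤ) + 1) + ((t : ℤ) + 1) = 2 * d + 2 - r then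
          (-1 : F) ^ (d - (s : ℕ)) • block M c s t else 0)

/-- The diagonal sum condition. -/
def DS (ℓ d : ℕ) {n : ℕ} (P : Matrix (Fin n) (Fin n) F[X])
    (M : Matrix (Fin (d + 1) × Fin n) (Fin (d + 1) × Fin n) F[X]) : Prop :=
  (∀ r : ℕ, r ≤ 2 * d + 1 →
    coeffMatrix P (ℓ * r) =
      (∑ s : Fin (d + 1), ∑ t : Fin (d + 1),
        if ((s : ℤ) + 1) - ((t : ℤ) + 1) = r - d then block M 0 s t else 0) +
      ∑ s : Fin (d + 1), ∑ t : Fin (d + 1),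
        if ((s : ℤ) + 1) - ((t : ℤ) + 1) = r - d - 1 then block M ℓ s t else 0) ∧
  (∀ r : ℕ, r ≤ 2 * d → ∀ c : ℕ, 1 ≤ c → c ≤ ℓ - 1 →
    coeffMatrix P (ℓ * r + c) =
      ∑ s : Fin (d + 1), ∑ t : Fin (d + 1),
        if ((s : ℤ) + 1) - ((t : ℤ) + 1) = r - d then block M c s t else 0)

end

end MatPoly

namespace MatPoly

noncomputable section

/-! ### Moebius transformations of scalar polynomials -/

section Scalar

variable {F : Type*} [Field F]

/-- The Moebius transformation of a scalar polynomial of grade `k`. -/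
def moebiusPoly (k : ℕ) (A : Matrix (Fin 2) (Fin 2) F) (p : F[X]) : F[X] :=
  ∑ j ∈ Finset.range (k + 1),
    C (p.coeff j) * (C (A 0 0) * X + C (A 0 1)) ^ j * (C (A 1 0) * X + C (A 1 1)) ^ (k - j)

theorem moebius_eq_map {m n : Type*} (k : ℕ) (A : Matrix (Fin 2) (Fin 2) F) (P : Matrix m n F[X]) :
    moebius k A P = P.map (moebiusPoly k A) := rfl

theorem moebiusPoly_zero (k : ℕ) (A : Matrix (Fin 2) (Fin 2) F) : moebiusPoly k A 0 = 0 := by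
  simp [moebiusPoly]

theorem moebiusPoly_add (k : ℕ) (A : Matrix (Fin 2) (Fin 2) F) (p q : F[X]) :
    moebiusPoly k A (p + q) = moebiusPoly k A p + moebiusPoly k A q := by
  simp [moebiusPoly, add_mul, Finset.sum_add_distrib]

theorem moebiusPoly_sum {ι : Type*} (s : Finset ι) (k : ℕ) (A : Matrix (Fin 2) (Fin 2) F)
    (p : ι → F[X]) : moebiusPoly k A (∑ i ∈ s, p i) = ∑ i ∈ s, moebiusPoly k A (p i) :=
  map_sum (AddMonoidHom.mk' (moebiusPoly k A) (moebiusPoly_add k A)) p s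

theorem moebiusPoly_smul (k : ℕ) (A : Matrix (Fin 2) (Fin 2) F) (a : F) (p : F[X]) :
    moebiusPoly k A (a • p) = a • moebiusPoly k A p := by
  simp [moebiusPoly, smul_eq_C_mul, Finset.mul_sum, mul_assoc]

theorem moebiusPoly_A₁ {k : ℕ} {p : F[X]} (hp : p.natDegree ≤ k) :
    moebiusPoly k (A₁ F) p = p := by
  conv_rhs => rw [p.as_sum_range' (k + 1) (by omega)]
  simp [moebiusPoly, A₁, C_mul_X_pow_eq_monomial]

theorem moebiusPoly_A₂ {k : ℕ} {p : F[X]} (hp : p.natDegree ≤ k) :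
    moebiusPoly k (A₂ F) p = p.comp (-X) := by
  conv_rhs => rw [comp, eval₂_eq_sum_range' C (show p.natDegree < k + 1 by omega)]
  simp [moebiusPoly, A₂]

theorem moebiusPoly_A₃ {k : ℕ} {p : F[X]} (hp : p.natDegree ≤ k) :
    moebiusPoly k (A₃ F) p = reflect k p := by
  conv_rhs => rw [p.as_sum_range' (k + 1) (by omega)]
  have h : ∀ s : Finset ℕ, reflect k (∑ j ∈ s, monomial j (p.coeff j)) =
      ∑ j ∈ s, reflect k (monomial j (p.coeff j)) := fun s =>
    map_sum (AddMonoidHom.mk' (reflect k) (fun f g => reflect_add f g k)) _ s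
  rw [h]
  refine Finset.sum_congr rfl fun j hj => ?_
  have hj' : j ≤ k := by simpa [Nat.lt_succ_iff] using hj
  rw [← C_mul_X_pow_eq_monomial, reflect_C_mul_X_pow, revAt_le hj']
  simp [A₃]

variable (F) in
/-- The matrix is one of the three structure matrices. -/
def IsStructureMatrix (A : Matrix (Fin 2) (Fin 2) F) : Prop :=
  A = A₁ F ∨ A = A₂ F ∨ A = A₃ F

variable {A : Matrix (Fin 2) (Fin 2) F}

theorem natDegree_reflect_le_of_le {k : ℕ} {p : F[X]} (hp : p.natDegree ≤ k) :
    (reflect k p).natDegree ≤ k := by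
  simpa [hp] using natDegree_reflect_le (p := p) (N := k)

theorem IsStructureMatrix.natDegree_le (hA : IsStructureMatrix F A) {k : ℕ} {p : F[X]}
    (hp : p.natDegree ≤ k) : (moebiusPoly k A p).natDegree ≤ k := by
  rcases hA with rfl | rfl | rfl
  · rwa [moebiusPoly_A₁ hp]
  · rw [moebiusPoly_A₂ hp]
    simpa [natDegree_comp] using hp
  · rw [moebiusPoly_A₃ hp]
    exact natDegree_reflect_le_of_le hp

theorem IsStructureMatrix.moebiusPoly_moebiusPoly (hA : IsStructureMatrix F A) {k : ℕ} {p : F[X]}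
    (hp : p.natDegree ≤ k) : moebiusPoly k A (moebiusPoly k A p) = p := by
  have h := hA.natDegree_le hp
  rcases hA with rfl | rfl | rfl
  · rw [moebiusPoly_A₁ h, moebiusPoly_A₁ hp]
  · rw [moebiusPoly_A₂ h, moebiusPoly_A₂ hp, comp_assoc]
    simp
  · rw [moebiusPoly_A₃ h, moebiusPoly_A₃ hp]
    exact reflect_reflect

theorem IsStructureMatrix.moebiusPoly_mul (hA : IsStructureMatrix F A) {k l : ℕ} {p q : F[X]}
    (hp : p.natDegree ≤ k) (hq : q.natDegree ≤ l) :
    moebiusPoly (k + l) A (p * q) = moebiusPoly k A p * moebiusPoly l A q := by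
  have h : (p * q).natDegree ≤ k + l := natDegree_mul_le.trans (add_le_add hp hq)
  rcases hA with rfl | rfl | rfl
  · rw [moebiusPoly_A₁ h, moebiusPoly_A₁ hp, moebiusPoly_A₁ hq]
  · rw [moebiusPoly_A₂ h, moebiusPoly_A₂ hp, moebiusPoly_A₂ hq, mul_comp]
  · rw [moebiusPoly_A₃ h, moebiusPoly_A₃ hp, moebiusPoly_A₃ hq, reflect_mul p q hp hq]

theorem IsStructureMatrix.map_moebiusPoly (hA : IsStructureMatrix F A) (σ : F →+* F) (k : ℕ)
    (p : F[X]) : (moebiusPoly k A p).map σ = moebiusPoly k A (p.map σ) := by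
  rcases hA with rfl | rfl | rfl <;>
    simp [moebiusPoly, A₁, A₂, A₃, Polynomial.map_sum]

end Scalar

/-! ### Completions of matrices over commutative rings -/

section Completion

open Matrix

variable {R : Type*} [CommRing R] {a b n a' b' n' : Type*}

/-- `[X; w]` and `[Z, v]` are mutually inverse, so that the columns of `v` span the kernel
of `X`. -/
structure IsCompletion [Fintype a] [Fintype b] [Fintype n] [DecidableEq a] [DecidableEq b]
    [DecidableEq n] (X : Matrix b a R) (v : Matrix a n R) (Z : Matrix a b R) (w : Matrix n a R) :
    Prop where
  mul_right : X * Z = 1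
  mul_ker : X * v = 0
  ker_mul : w * v = 1
  left_mul : w * Z = 0
  add_eq_one : Z * X + v * w = 1

variable [Fintype a] [Fintype b] [Fintype n] [DecidableEq a] [DecidableEq b] [DecidableEq n]
  [Fintype a'] [Fintype b'] [Fintype n'] [DecidableEq a'] [DecidableEq b'] [DecidableEq n']
  {X : Matrix b a R} {v : Matrix a n R} {Z : Matrix a b R} {w : Matrix n a R}

theorem IsCompletion.of_equiv (e : b ⊕ n ≃ a) (h₁ : X * Z = 1) (h₂ : X * v = 0) (h₃ : w * v = 1)
    (h₄ : w * Z = 0) : IsCompletion X v Z w := by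
  refine ⟨h₁, h₂, h₃, h₄, ?_⟩
  have h : fromRows X w * fromCols Z v = 1 := by
    rw [fromRows_mul_fromCols, h₁, h₂, h₃, h₄, fromBlocks_one]
  rw [mul_eq_one_comm_of_equiv e, fromCols_mul_fromRows] at h
  exact h

theorem IsCompletion.submatrix (h : IsCompletion X v Z w) (e₁ : b' ≃ b) (e₂ : a' ≃ a)
    (e₃ : n' ≃ n) :
    IsCompletion (X.submatrix e₁ e₂) (v.submatrix e₂ e₃) (Z.submatrix e₂ e₁)
      (w.submatrix e₃ e₂) := by
  refine ⟨?_, ?_, ?_, ?_, ?_⟩ <;> simp only [submatrix_mul_equiv, h.mul_right, h.mul_ker, h.ker_mul,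
    h.left_mul, submatrix_one_equiv, submatrix_zero, Pi.zero_apply]
  rw [← submatrix_one_equiv e₂, ← h.add_eq_one]
  rfl

theorem IsCompletion.kronecker_one (h : IsCompletion X v Z w) :
    IsCompletion (X ⊗ₖ (1 : Matrix n' n' R)) (v ⊗ₖ (1 : Matrix n' n' R))
      (Z ⊗ₖ (1 : Matrix n' n' R)) (w ⊗ₖ (1 : Matrix n' n' R)) := by
  refine ⟨?_, ?_, ?_, ?_, ?_⟩ <;> simp only [← mul_kronecker_mul, h.mul_right, h.mul_ker,
    h.ker_mul, h.left_mul, mul_one, one_kronecker_one, zero_kronecker]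
  rw [← add_kronecker, h.add_eq_one, one_kronecker_one]

end Completion

/-! ### Bidiagonal matrices and their kernels -/

section Bidiagonal

open Matrix

variable {R : Type*} [CommRing R]

/-- The `d × (d+1)` matrix with `c` on the diagonal and `e` on the superdiagonal. -/
def bidiagonal (d : ℕ) (c e : R) : Matrix (Fin d) (Fin (d + 1)) R :=
  Matrix.of fun i j => if j = i.castSucc then c else if j = i.succ then e else 0

theorem bidiagonal_eq (d : ℕ) (c e : R) (i : Fin d) (j : Fin (d + 1)) :
    bidiagonal d c e i j = (if j = i.castSucc then c else 0) + if j = i.succ then e else 0 := by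
  have : i.castSucc ≠ i.succ := (Fin.castSucc_lt_succ).ne
  by_cases h : j = i.castSucc
  · subst h; simp [bidiagonal, this]
  · simp [bidiagonal, h]

theorem bidiagonal_mulVec {d : ℕ} (c e : R) (y : Fin (d + 1) → R) (i : Fin d) :
    (bidiagonal d c e *ᵥ y) i = c * y i.castSucc + e * y i.succ := by
  simp [mulVec, dotProduct, bidiagonal_eq, add_mul, Finset.sum_add_distrib]

theorem bidiagonal_mul {d : ℕ} {n : Type*} (c e : R) (Y : Matrix (Fin (d + 1)) n R) (i : Fin d)
    (j : n) : (bidiagonal d c e * Y) i j = c * Y i.castSucc j + e * Y i.succ j :=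
  bidiagonal_mulVec c e (fun k => Y k j) i

theorem bidiagonal_rev {d : ℕ} (c e : R) :
    (bidiagonal d c e).submatrix Fin.revPerm Fin.revPerm = bidiagonal d e c := by
  ext i j
  have h1 : (j.rev = i.rev.castSucc) ↔ j = i.succ := by
    rw [← Fin.rev_succ, Fin.rev_inj]
  have h2 : (j.rev = i.rev.succ) ↔ j = i.castSucc := by
    rw [← Fin.rev_castSucc, Fin.rev_inj]
  simp [bidiagonal_eq, h1, h2, add_comm]

/-- A vector as a matrix with one column. -/
def colMatrix {m : Type*} (f : m → R) : Matrix m Unit R := Matrix.of fun i _ => f i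

theorem exists_isCompletion_bidiagonal_of_diag {d : ℕ} {c e : R} (hc : IsUnit c)
    {f : Fin (d + 1) → R} (hf : ∀ i : Fin d, c * f i.castSucc + e * f i.succ = 0)
    (hl : IsUnit (f (Fin.last d))) :
    ∃ Z w, IsCompletion (bidiagonal d c e) (colMatrix f) Z w := by
  obtain ⟨c', hc'⟩ := hc.exists_right_inv
  obtain ⟨l, hl'⟩ := hl.exists_left_inv
  refine ⟨Matrix.of fun j i => if (j : ℕ) ≤ i then c' * (-e * c') ^ ((i : ℕ) - j) else 0,
    Matrix.of fun _ j => if j = Fin.last d then l else 0,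
    IsCompletion.of_equiv (Fintype.equivOfCardEq (by simp)) ?_ ?_ ?_ ?_⟩
  · ext i j
    rw [bidiagonal_mul]
    rcases lt_trichotomy (i : ℕ) j with h | h | h
    · have h1 : (i : ℕ) + 1 ≤ j := h
      obtain ⟨m, hm⟩ := Nat.exists_eq_add_of_le h1
      have h2 : (j : ℕ) - i = m + 1 := by omega
      have h3 : (j : ℕ) - (i + 1) = m := by omega
      rw [Matrix.one_apply_ne (by rintro rfl; omega)]
      simp only [of_apply, Fin.val_castSucc, Fin.val_succ, h.le, h1, if_true, h2, h3]
      linear_combination (-e * c') ^ m * (- e * c') * hc'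
    · obtain rfl := Fin.ext h
      simp [hc']
    · rw [Matrix.one_apply_ne (by rintro rfl; omega)]
      simp [show ¬ (i : ℕ) ≤ j by omega, show ¬ (i : ℕ) + 1 ≤ j by omega]
  · ext i j
    rw [bidiagonal_mul]
    exact hf i
  · ext i j
    simp [mul_apply, colMatrix, hl']
  · ext i j
    rw [mul_apply]
    refine Finset.sum_eq_zero fun x _ => ?_
    by_cases hx : x = Fin.last d
    · subst hx
      simp [show ¬ d ≤ (j : ℕ) by omega]
    · simp [hx]

theorem exists_isCompletion_bidiagonal_of_superdiag {d : ℕ} {c e : R} (he : IsUnit e)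
    {f : Fin (d + 1) → R} (hf : ∀ i : Fin d, c * f i.castSucc + e * f i.succ = 0)
    (h0 : IsUnit (f 0)) :
    ∃ Z w, IsCompletion (bidiagonal d c e) (colMatrix f) Z w := by
  obtain ⟨Z, w, h⟩ := exists_isCompletion_bidiagonal_of_diag (e := c) he (f := fun i => f i.rev)
    (fun i => by
      have := hf i.rev
      rw [Fin.rev_castSucc, Fin.rev_succ]
      linear_combination this) (by simpa using h0)
  have h' := h.submatrix Fin.revPerm Fin.revPerm (Equiv.refl _)
  rw [bidiagonal_rev] at h'
  have hv : (colMatrix fun i => f i.rev).submatrix Fin.revPerm (Equiv.refl Unit) =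
      colMatrix f := by
    ext i j
    simp [colMatrix]
  rw [hv] at h'
  exact ⟨_, _, h'⟩

end Bidiagonal

/-! ### Ellifications from completions -/

section Ellification

open Matrix

variable {F : Type*} [Field F]

theorem isUnimodular_of_isUnit_det {m : Type*} [Fintype m] [DecidableEq m] {U : Matrix m m F[X]}
    (h : IsUnit U.det) : IsUnimodular U := by
  obtain ⟨c, hc, h⟩ := Polynomial.isUnit_iff.1 h
  exact ⟨c, hc.ne_zero, h.symm⟩

theorem isEllification_of_equivalence {m n r : Type*} [Fintype m] [DecidableEq m] [Fintype n]
    [DecidableEq n] [Fintype r] [DecidableEq r] {ℓ k : ℕ} {L : Matrix m m F[X]}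
    {P : Matrix n n F[X]} (hL : HasGrade ℓ L) (hP : HasGrade k P) (e : r ⊕ n ≃ m)
    {U V' : Matrix (r ⊕ n) m F[X]} {U' V : Matrix m (r ⊕ n) F[X]} (hU : U * U' = 1)
    (hV : V' * V = 1)
    (h : U * L = (fromBlocks 1 0 0 P : Matrix (r ⊕ n) (r ⊕ n) F[X]) * V') :
    IsEllification ℓ k L P := by
  refine ⟨hL, hP, Fintype.card r,
    ((Fintype.equivFin r).symm.sumCongr (Equiv.refl n)).trans e,
    U.submatrix e.symm (Equiv.refl m), V.submatrix (Equiv.refl m) e.symm, ?_, ?_, ?_⟩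
  · refine isUnimodular_of_isUnit_det (isUnit_det_of_right_inverse
      (B := U'.submatrix (Equiv.refl m) e.symm) ?_)
    rw [submatrix_mul_equiv, hU, submatrix_one_equiv]
  · refine isUnimodular_of_isUnit_det (isUnit_det_of_left_inverse
      (B := V'.submatrix e.symm (Equiv.refl m)) ?_)
    rw [submatrix_mul_equiv, hV, submatrix_one_equiv]
  · have hD : (fromBlocks 1 0 0 P : Matrix (Fin (Fintype.card r) ⊕ n) _ F[X]) =
        (fromBlocks 1 0 0 P).submatrix ((Fintype.equivFin r).symm.sumCongr (Equiv.refl n))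
          ((Fintype.equivFin r).symm.sumCongr (Equiv.refl n)) := by
      ext (i | i) (j | j) <;> simp [Matrix.one_apply]
    have hE : U.submatrix e.symm (Equiv.refl m) * L * V.submatrix (Equiv.refl m) e.symm =
        (U * L * V).submatrix e.symm e.symm := by
      rw [← submatrix_mul_equiv _ _ _ (Equiv.refl m), ← submatrix_mul_equiv _ _ _ (Equiv.refl m)]
      rfl
    rw [hE, h, Matrix.mul_assoc, hV, Matrix.mul_one, hD, reindex_apply, submatrix_submatrix]
    congr 1 <;> ext x <;> simp

variable {a b n : Type*} [Fintype a] [Fintype b] [Fintype n] [DecidableEq a] [DecidableEq b]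
  [DecidableEq n] {X Y : Matrix b a F[X]} {v u : Matrix a n F[X]} {Z Z' : Matrix a b F[X]}
  {w w' : Matrix n a F[X]} {M : Matrix a a F[X]}

theorem isEllification_of_isCompletion {ℓ k : ℕ} (e : b ⊕ n ≃ a) (hX : IsCompletion X v Z w)
    (hY : IsCompletion Y u Z' w') (hL : HasGrade ℓ (fromBlocks M Yᵀ X 0))
    (hP : HasGrade k (uᵀ * M * v)) :
    IsEllification ℓ k (fromBlocks M Yᵀ X 0) (uᵀ * M * v) := by
  have y1 : Z'ᵀ * Yᵀ = 1 := by rw [← transpose_mul, hY.mul_right, transpose_one]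
  have y2 : uᵀ * Yᵀ = 0 := by rw [← transpose_mul, hY.mul_ker, transpose_zero]
  have y3 : uᵀ * w'ᵀ = 1 := by rw [← transpose_mul, hY.ker_mul, transpose_one]
  have y4 : Z'ᵀ * w'ᵀ = 0 := by rw [← transpose_mul, hY.left_mul, transpose_zero]
  refine isEllification_of_equivalence (r := b ⊕ b) hL hP
    (((Equiv.sumAssoc b b n).trans ((Equiv.refl b).sumCongr e)).trans (Equiv.sumComm b a))
    (U := fromRows (fromBlocks 0 1 Z'ᵀ 0) (fromCols uᵀ (-(uᵀ * M * Z))))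
    (U' := fromCols (fromBlocks (w'ᵀ * (uᵀ * M * Z)) Yᵀ 1 0) (fromRows w'ᵀ 0))
    (V := fromCols (fromBlocks Z 0 (-(Z'ᵀ * M * Z)) 1) (fromRows v (-(Z'ᵀ * M * v))))
    (V' := fromRows (fromBlocks X 0 (Z'ᵀ * M) 1) (fromCols w 0)) ?_ ?_ ?_
  · rw [fromRows_mul_fromCols, ← fromBlocks_one, ← fromBlocks_one]
    congr 1
    · simp [fromBlocks_multiply, y1, ← Matrix.mul_assoc, y4]
    · simp [fromBlocks_mul_fromRows, y4]
    · simp [fromCols_mul_fromBlocks, ← Matrix.mul_assoc, y3, y2]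
    · simp [fromCols_mul_fromRows, y3]
  · rw [fromRows_mul_fromCols, ← fromBlocks_one, ← fromBlocks_one]
    congr 1
    · simp [fromBlocks_multiply, hX.mul_right]
    · simp [fromBlocks_mul_fromRows, hX.mul_ker]
    · simp [fromCols_mul_fromBlocks, hX.left_mul]
    · simp [fromCols_mul_fromRows, hX.ker_mul]
  · have hvw : v * w = 1 - Z * X := eq_sub_of_add_eq' hX.add_eq_one
    rw [fromRows_mul, fromBlocks_mul_fromRows, fromBlocks_multiply, fromCols_mul_fromBlocks]
    congr 1
    · simp [y1]
    · simp only [Matrix.zero_mul, zero_add, mul_fromCols, Matrix.mul_zero, Matrix.mul_assoc, hvw,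
        y2, add_zero, Matrix.neg_mul]
      simp [Matrix.mul_sub, ← sub_eq_add_neg]

end Ellification

/-! ### Transfer of minimal indices -/

section MinimalIndices

open Matrix

variable {F : Type*} [Field F]

theorem IsPolynomialBasis.ne_zero {n : Type*}
    {N₁ : Submodule (RatFunc F) (n → RatFunc F)} {p : ℕ} {v : Fin p → n → F[X]}
    (hv : IsPolynomialBasis N₁ v) (i : Fin p) : v i ≠ 0 := by
  intro h
  refine hv.1.ne_zero i ?_
  ext j
  simp [h]

theorem IsPolynomialBasis.mem {n : Type*}
    {N₁ : Submodule (RatFunc F) (n → RatFunc F)} {p : ℕ} {v : Fin p → n → F[X]}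
    (hv : IsPolynomialBasis N₁ v) (i : Fin p) : (fun j => algebraMap F[X] (RatFunc F) (v i j)) ∈ N₁ := by
  rw [← hv.2]
  exact Submodule.subset_span ⟨i, rfl⟩

variable {m n : Type*} [Fintype m] [Fintype n]

theorem map_algebraMap_mulVec {m : Type*} (G : Matrix m n F[X]) (x : n → F[X]) :
    (G.map (algebraMap F[X] (RatFunc F))) *ᵥ (fun j => algebraMap F[X] (RatFunc F) (x j)) =
      fun i => algebraMap F[X] (RatFunc F) ((G *ᵥ x) i) := by
  ext i
  exact (RingHom.map_mulVec _ G x i).symm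

theorem mem_rightNullspace {m : Type*} {P : Matrix m n F[X]} {x : n → RatFunc F} :
    x ∈ rightNullspace P ↔ P.map (algebraMap F[X] (RatFunc F)) *ᵥ x = 0 := by
  simp [rightNullspace]

theorem algebraMap_mem_rightNullspace {m : Type*} {P : Matrix m n F[X]} {x : n → F[X]} :
    (fun j => algebraMap F[X] (RatFunc F) (x j)) ∈ rightNullspace P ↔ P *ᵥ x = 0 := by
  rw [mem_rightNullspace, map_algebraMap_mulVec, funext_iff, funext_iff]
  simp

variable {N₁ : Submodule (RatFunc F) (n → RatFunc F)} {N₂ : Submodule (RatFunc F) (m → RatFunc F)}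

theorem IsPolynomialBasis.mulVec {p : ℕ} {v : Fin p → n → F[X]} (hv : IsPolynomialBasis N₁ v)
    (G : Matrix m n F[X]) (H : Matrix n m F[X])
    (hG : ∀ x ∈ N₁, G.map (algebraMap F[X] (RatFunc F)) *ᵥ x ∈ N₂)
    (hH : ∀ y ∈ N₂, H.map (algebraMap F[X] (RatFunc F)) *ᵥ y ∈ N₁)
    (hHG : ∀ x ∈ N₁, H.map (algebraMap F[X] (RatFunc F)) *ᵥ
      (G.map (algebraMap F[X] (RatFunc F)) *ᵥ x) = x)
    (hGH : ∀ y ∈ N₂, G.map (algebraMap F[X] (RatFunc F)) *ᵥ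
      (H.map (algebraMap F[X] (RatFunc F)) *ᵥ y) = y) :
    IsPolynomialBasis N₂ (fun i => G *ᵥ v i) := by
  have hmem := hv.mem
  obtain ⟨h₁, h₂⟩ := hv
  constructor
  · refine LinearIndependent.of_comp (H.map (algebraMap F[X] (RatFunc F))).mulVecLin ?_
    convert h₁ using 1
    funext i
    simp only [Function.comp, mulVecLin_apply]
    rw [← map_algebraMap_mulVec, hHG _ (hmem i)]
  · have hr : (Set.range fun (i : Fin p) (j : m) => algebraMap F[X] (RatFunc F) ((G *ᵥ v i) j)) =
        (G.map (algebraMap F[X] (RatFunc F))).mulVecLin ''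
          Set.range fun (i : Fin p) (j : n) => algebraMap F[X] (RatFunc F) (v i j) := by
      rw [← Set.range_comp]
      congr 1
      funext i
      simp only [Function.comp, mulVecLin_apply]
      rw [← map_algebraMap_mulVec]
    rw [hr, Submodule.span_image, h₂]
    apply le_antisymm
    · rintro _ ⟨x, hx, rfl⟩
      exact hG x hx
    · intro y hy
      exact ⟨_, hH y hy, hGH y hy⟩

theorem areMinimalIndicesOf_iff_of_mulVec (G : Matrix m n F[X]) (H : Matrix n m F[X]) (D : ℕ)
    (hG : ∀ x ∈ N₁, G.map (algebraMap F[X] (RatFunc F)) *ᵥ x ∈ N₂)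
    (hH : ∀ y ∈ N₂, H.map (algebraMap F[X] (RatFunc F)) *ᵥ y ∈ N₁)
    (hHG : ∀ x ∈ N₁, H.map (algebraMap F[X] (RatFunc F)) *ᵥ
      (G.map (algebraMap F[X] (RatFunc F)) *ᵥ x) = x)
    (hGH : ∀ y ∈ N₂, G.map (algebraMap F[X] (RatFunc F)) *ᵥ
      (H.map (algebraMap F[X] (RatFunc F)) *ᵥ y) = y)
    (hdeg : ∀ z : n → F[X], z ≠ 0 → (fun j => algebraMap F[X] (RatFunc F) (z j)) ∈ N₁ →
      vecDegree (G *ᵥ z) = vecDegree z + D) {p : ℕ} (δ : Fin p → ℕ) :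
    AreMinimalIndicesOf N₂ δ ↔
      ∃ η : Fin p → ℕ, AreMinimalIndicesOf N₁ η ∧ ∀ i, δ i = η i + D := by
  have hGv : ∀ {v : Fin p → n → F[X]}, IsPolynomialBasis N₁ v →
      IsPolynomialBasis N₂ (fun i => G *ᵥ v i) := fun hv => hv.mulVec G H hG hH hHG hGH
  have hHv : ∀ {v : Fin p → m → F[X]}, IsPolynomialBasis N₂ v →
      IsPolynomialBasis N₁ (fun i => H *ᵥ v i) := fun hv => hv.mulVec H G hH hG hGH hHG
  have hd : ∀ {v : Fin p → n → F[X]}, IsPolynomialBasis N₁ v → ∀ i,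
      vecDegree (G *ᵥ v i) = vecDegree (v i) + D := fun hv i => hdeg _ (hv.ne_zero i) (hv.mem i)
  have hinv : ∀ {v : Fin p → m → F[X]}, IsPolynomialBasis N₂ v → ∀ i,
      G *ᵥ (H *ᵥ v i) = v i := by
    intro v hv i
    have h := hGH _ (hv.mem i)
    rw [map_algebraMap_mulVec, map_algebraMap_mulVec] at h
    ext1 j
    exact RatFunc.algebraMap_injective F (congrFun h j)
  constructor
  · rintro ⟨hmono, v, ⟨hv, hmin⟩, hδ⟩
    have hδ' : ∀ i, δ i = vecDegree (H *ᵥ v i) + D := fun i => by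
      rw [← hd (hHv hv) i, hinv hv, hδ]
    refine ⟨fun i => vecDegree (H *ᵥ v i), ⟨fun i j hij => ?_, _, ⟨hHv hv, fun w hw => ?_⟩,
      fun i => rfl⟩, hδ'⟩
    · have := hmono hij
      rw [hδ', hδ'] at this
      exact Nat.le_of_add_le_add_right this
    · have := hmin _ (hGv hw)
      simp only [hδ, hδ', hd hw, Finset.sum_add_distrib] at this
      exact Nat.le_of_add_le_add_right this
  · rintro ⟨η, ⟨hmono, v, ⟨hv, hmin⟩, hη⟩, hδ⟩
    refine ⟨fun i j hij => ?_, _, ⟨hGv hv, fun w hw => ?_⟩, fun i => ?_⟩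
    · rw [hδ, hδ]
      exact Nat.add_le_add_right (hmono hij) D
    · have h1 := hmin _ (hHv hw)
      have h2 : ∀ i, vecDegree (w i) = vecDegree (H *ᵥ w i) + D := fun i => by
        rw [← hd (hHv hw) i, hinv hw]
      simp only [h2, hd hv, Finset.sum_add_distrib]
      exact Nat.add_le_add_right h1 _
    · rw [hδ, ← hη, hd hv]

theorem areRightMinimalIndices_iff_of_mul_eq {m' n' : Type*} [Fintype m'] [Fintype n']
    [DecidableEq m] [DecidableEq n] {L : Matrix m' m F[X]} {P : Matrix n' n F[X]}
    {G : Matrix m n F[X]} {H : Matrix n m F[X]} {E : Matrix m' n' F[X]} {E' : Matrix n' m' F[X]}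
    {S : Matrix m m' F[X]} (hLG : L * G = E * P) (hPH : P * H = E' * L) (hHG : H * G = 1)
    (hGH : G * H + S * L = 1) {D : ℕ}
    (hdeg : ∀ z : n → F[X], z ≠ 0 → P *ᵥ z = 0 → vecDegree (G *ᵥ z) = vecDegree z + D)
    {p : ℕ} (δ : Fin p → ℕ) :
    AreRightMinimalIndices L δ ↔
      ∃ η : Fin p → ℕ, AreRightMinimalIndices P η ∧ ∀ i, δ i = η i + D := by
  have hLG' := congrArg (fun Q => Q.map (algebraMap F[X] (RatFunc F))) hLG
  have hPH' := congrArg (fun Q => Q.map (algebraMap F[X] (RatFunc F))) hPH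
  have hHG' := congrArg (fun Q => Q.map (algebraMap F[X] (RatFunc F))) hHG
  have hGH' := congrArg (fun Q => Q.map (algebraMap F[X] (RatFunc F))) hGH
  simp only [Matrix.map_mul, Matrix.map_add _ (map_add (algebraMap F[X] (RatFunc F))),
    Matrix.map_one _ (map_zero (algebraMap F[X] (RatFunc F)))
      (map_one (algebraMap F[X] (RatFunc F)))] at hLG' hPH' hHG' hGH'
  refine areMinimalIndicesOf_iff_of_mulVec G H D ?_ ?_ ?_ ?_ ?_ δ
  · intro x hx
    rw [mem_rightNullspace] at hx ⊢
    rw [mulVec_mulVec, hLG', ← mulVec_mulVec, hx, mulVec_zero]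
  · intro x hx
    rw [mem_rightNullspace] at hx ⊢
    rw [mulVec_mulVec, hPH', ← mulVec_mulVec, hx, mulVec_zero]
  · intro x hx
    rw [mulVec_mulVec, hHG', one_mulVec]
  · intro x hx
    rw [mem_rightNullspace] at hx
    conv_rhs => rw [← one_mulVec x, ← hGH', add_mulVec, ← mulVec_mulVec, ← mulVec_mulVec, hx,
      mulVec_zero, add_zero]
  · intro z hz hz'
    exact hdeg z hz (algebraMap_mem_rightNullspace.1 hz')

theorem vecDegree_le_iff {v : n → F[X]} {D : ℕ} :
    vecDegree v ≤ D ↔ ∀ i, (v i).natDegree ≤ D := by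
  simp [vecDegree, Finset.sup_le_iff]

theorem natDegree_le_vecDegree (v : n → F[X]) (i : n) : (v i).natDegree ≤ vecDegree v :=
  vecDegree_le_iff.1 le_rfl i

theorem vecDegree_neg (v : n → F[X]) : vecDegree (-v) = vecDegree v := by
  simp [vecDegree]

theorem vecDegree_elim (x : m → F[X]) (y : n → F[X]) :
    vecDegree (Sum.elim x y) = max (vecDegree x) (vecDegree y) := by
  apply le_antisymm
  · rw [vecDegree_le_iff]
    rintro (i | i)
    · exact le_max_of_le_left (natDegree_le_vecDegree x i)
    · exact le_max_of_le_right (natDegree_le_vecDegree y i)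
  · refine max_le (vecDegree_le_iff.2 fun i => ?_) (vecDegree_le_iff.2 fun i => ?_)
    · exact natDegree_le_vecDegree (Sum.elim x y) (Sum.inl i)
    · exact natDegree_le_vecDegree (Sum.elim x y) (Sum.inr i)

theorem HasGrade.vecDegree_mulVec_le {ℓ : ℕ} {M : Matrix m n F[X]} (hM : HasGrade ℓ M)
    (x : n → F[X]) : vecDegree (M *ᵥ x) ≤ ℓ + vecDegree x := by
  rw [vecDegree_le_iff]
  intro i
  refine natDegree_sum_le_of_forall_le _ _ fun j _ => ?_
  exact natDegree_mul_le.trans (add_le_add (hM i j) (natDegree_le_vecDegree x j))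

variable {a b : Type*} [Fintype a] [Fintype b] [DecidableEq a] [DecidableEq b] [DecidableEq n]
  {X Y : Matrix b a F[X]} {v u : Matrix a n F[X]} {Z Z' : Matrix a b F[X]}
  {w w' : Matrix n a F[X]} {M : Matrix a a F[X]}

theorem areRightMinimalIndices_iff_of_isCompletion {ℓ D : ℕ} (hX : IsCompletion X v Z w)
    (hY : IsCompletion Y u Z' w') (hM : HasGrade ℓ M)
    (hv : ∀ z : n → F[X], z ≠ 0 → vecDegree (v *ᵥ z) = vecDegree z + D)
    (hYdeg : ∀ y : b → F[X], y ≠ 0 → vecDegree y + ℓ ≤ vecDegree (Yᵀ *ᵥ y))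
    {p : ℕ} (δ : Fin p → ℕ) :
    AreRightMinimalIndices (fromBlocks M Yᵀ X 0) δ ↔
      ∃ η : Fin p → ℕ, AreRightMinimalIndices (uᵀ * M * v) η ∧ ∀ i, δ i = η i + D := by
  have y1 : Z'ᵀ * Yᵀ = 1 := by rw [← transpose_mul, hY.mul_right, transpose_one]
  have y2 : uᵀ * Yᵀ = 0 := by rw [← transpose_mul, hY.mul_ker, transpose_zero]
  have y5 : Yᵀ * Z'ᵀ + w'ᵀ * uᵀ = 1 := by
    rw [← transpose_mul, ← transpose_mul, ← transpose_add, hY.add_eq_one, transpose_one]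
  have hvw : v * w = 1 - Z * X := eq_sub_of_add_eq' hX.add_eq_one
  have hwu : w'ᵀ * uᵀ = 1 - Yᵀ * Z'ᵀ := eq_sub_of_add_eq' y5
  have hLG : fromBlocks M Yᵀ X 0 * fromRows v (-(Z'ᵀ * M * v)) =
      fromRows w'ᵀ (0 : Matrix b n F[X]) * (uᵀ * M * v) := by
    rw [fromBlocks_mul_fromRows, fromRows_mul, hX.mul_ker]
    congr 1
    · rw [← Matrix.mul_assoc, ← Matrix.mul_assoc, hwu]
      simp [Matrix.sub_mul, Matrix.mul_assoc, ← sub_eq_add_neg]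
    · simp
  refine areRightMinimalIndices_iff_of_mul_eq
    (G := fromRows v (-(Z'ᵀ * M * v))) (H := fromCols w 0)
    (E := fromRows w'ᵀ 0) (E' := fromCols uᵀ (-(uᵀ * M * Z)))
    (S := fromBlocks 0 Z Z'ᵀ (-(Z'ᵀ * M * Z))) hLG ?_ ?_ ?_ ?_ δ
  · simp only [mul_fromCols, fromCols_mul_fromBlocks, Matrix.mul_zero, Matrix.mul_assoc, hvw,
        y2, add_zero, Matrix.neg_mul]
    simp [Matrix.mul_sub, ← sub_eq_add_neg]
  · simp [fromCols_mul_fromRows, hX.ker_mul]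
  · rw [fromRows_mul_fromCols, fromBlocks_multiply, fromBlocks_add, ← fromBlocks_one]
    congr 1
    · simpa [add_comm] using hX.add_eq_one
    · simp
    · simp only [Matrix.neg_mul, Matrix.mul_assoc, hvw]
      simp only [Matrix.mul_sub, Matrix.mul_one]
      abel
    · simp [y1]
  · intro z hz hPz
    set y := -(Z'ᵀ * M * v) *ᵥ z with hy
    have hG : fromRows v (-(Z'ᵀ * M * v)) *ᵥ z = Sum.elim (v *ᵥ z) y := by
      rw [fromRows_mulVec]
    have hker : M *ᵥ (v *ᵥ z) + Yᵀ *ᵥ y = 0 := by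
      have h : (fromBlocks M Yᵀ X 0) *ᵥ Sum.elim (v *ᵥ z) y = 0 := by
        rw [← hG, mulVec_mulVec, hLG, ← mulVec_mulVec, hPz, mulVec_zero]
      rw [fromBlocks_mulVec] at h
      ext1 i
      simpa using congrFun h (Sum.inl i)
    rw [hG, vecDegree_elim, hv z hz, max_eq_left]
    by_cases hy0 : y = 0
    · simp [hy0, vecDegree]
    · have h1 := hYdeg y hy0
      rw [eq_neg_of_add_eq_zero_right hker, vecDegree_neg] at h1
      have h2 := hM.vecDegree_mulVec_le (v *ᵥ z)
      rw [hv z hz] at h2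
      omega

end MinimalIndices

/-! ### Dual pencils -/

section DualPencil

open Matrix

variable {F : Type*} [Field F]

/-- `c` and `e` are the entries of a pencil in `λ^ℓ`, one of them a nonzero constant and the other
a nonzero multiple of `λ^ℓ`, and `f` is the corresponding monomial vector in the kernel of
`bidiagonal d c e`. -/
def IsDualPencil (d ℓ : ℕ) (c e : F[X]) (f : Fin (d + 1) → F[X]) : Prop :=
  ∃ (α β : F) (κ : Fin (d + 1) → F), α ≠ 0 ∧ β ≠ 0 ∧ (∀ i, κ i ≠ 0) ∧
    (∀ i : Fin d, α * κ i.castSucc + β * κ i.succ = 0) ∧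
    ((c = C α ∧ e = C β * X ^ ℓ ∧ ∀ i, f i = C (κ i) * X ^ (ℓ * (d - (i : ℕ)))) ∨
      (c = C α * X ^ ℓ ∧ e = C β ∧ ∀ i, f i = C (κ i) * X ^ (ℓ * (i : ℕ))))

variable {d ℓ : ℕ} {c e : F[X]} {f : Fin (d + 1) → F[X]}

theorem IsDualPencil.natDegree_le (h : IsDualPencil d ℓ c e f) :
    c.natDegree ≤ ℓ ∧ e.natDegree ≤ ℓ ∧ ∀ i, (f i).natDegree ≤ ℓ * d := by
  obtain ⟨α, β, κ, -, -, -, -, ⟨rfl, rfl, hf⟩ | ⟨rfl, rfl, hf⟩⟩ := h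
  · refine ⟨by simp, natDegree_C_mul_X_pow_le _ _, fun i => ?_⟩
    rw [hf]
    exact (natDegree_C_mul_X_pow_le _ _).trans (Nat.mul_le_mul_left _ (Nat.sub_le _ _))
  · refine ⟨natDegree_C_mul_X_pow_le _ _, by simp, fun i => ?_⟩
    rw [hf]
    exact (natDegree_C_mul_X_pow_le _ _).trans (Nat.mul_le_mul_left _ i.is_le)

theorem IsDualPencil.exists_isCompletion (h : IsDualPencil d ℓ c e f) :
    ∃ Z w, IsCompletion (bidiagonal d c e) (colMatrix f) Z w := by
  obtain ⟨α, β, κ, hα, hβ, hκ, hrel, ⟨rfl, rfl, hf⟩ | ⟨rfl, rfl, hf⟩⟩ := h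
  · refine exists_isCompletion_bidiagonal_of_diag (isUnit_C.2 hα.isUnit) (fun i => ?_) ?_
    · have h1 : d - (i : ℕ) = d - (i + 1) + 1 := by omega
      have h2 : C α * C (κ i.castSucc) + C β * C (κ i.succ) = 0 := by
        rw [← C_mul, ← C_mul, ← C_add, hrel, C_0]
      simp only [hf, Fin.val_castSucc, Fin.val_succ, h1, mul_add, mul_one, pow_add]
      linear_combination X ^ (ℓ * (d - (i + 1))) * X ^ ℓ * h2
    · simpa [hf] using hκ _
  · refine exists_isCompletion_bidiagonal_of_superdiag (isUnit_C.2 hβ.isUnit) (fun i => ?_) ?_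
    · have h2 : C α * C (κ i.castSucc) + C β * C (κ i.succ) = 0 := by
        rw [← C_mul, ← C_mul, ← C_add, hrel, C_0]
      simp only [hf, Fin.val_castSucc, Fin.val_succ, mul_add, mul_one, pow_add]
      linear_combination X ^ (ℓ * (i : ℕ)) * X ^ ℓ * h2
    · simpa [hf] using hκ _

theorem IsDualPencil.reflect (h : IsDualPencil d ℓ c e f) :
    IsDualPencil d ℓ (reflect ℓ c) (reflect ℓ e) (fun i => reflect (ℓ * d) (f i)) := by
  obtain ⟨α, β, κ, hα, hβ, hκ, hrel, ⟨rfl, rfl, hf⟩ | ⟨rfl, rfl, hf⟩⟩ := h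
  · refine ⟨α, β, κ, hα, hβ, hκ, hrel, Or.inr ⟨reflect_C _ _, ?_, fun i => ?_⟩⟩
    · rw [reflect_C_mul_X_pow, revAt_le le_rfl]
      simp
    · beta_reduce
      rw [hf, reflect_C_mul_X_pow, revAt_le (Nat.mul_le_mul_left _ (Nat.sub_le _ _)),
        ← Nat.mul_sub, Nat.sub_sub_self i.is_le]
  · refine ⟨α, β, κ, hα, hβ, hκ, hrel, Or.inl ⟨?_, reflect_C _ _, fun i => ?_⟩⟩
    · rw [reflect_C_mul_X_pow, revAt_le le_rfl]
      simp
    · beta_reduce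
      rw [hf, reflect_C_mul_X_pow, revAt_le (Nat.mul_le_mul_left _ i.is_le), ← Nat.mul_sub]

theorem C_mul_X_pow_comp_neg_X (a : F) (j : ℕ) :
    (C a * X ^ j).comp (-X) = C (a * (-1) ^ j) * X ^ j := by
  rw [mul_comp, C_comp, X_pow_comp, neg_pow, C_mul, C_pow, C_neg, C_1, mul_assoc]

theorem IsDualPencil.comp_neg_X (h : IsDualPencil d ℓ c e f) :
    IsDualPencil d ℓ (c.comp (-X)) (e.comp (-X)) (fun i => (f i).comp (-X)) := by
  have h1 : ∀ j, (-1 : F) ^ j ≠ 0 := fun j => pow_ne_zero _ (by simp)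
  obtain ⟨α, β, κ, hα, hβ, hκ, hrel, ⟨rfl, rfl, hf⟩ | ⟨rfl, rfl, hf⟩⟩ := h
  · refine ⟨α, β * (-1) ^ ℓ, fun i => κ i * (-1) ^ (ℓ * (d - (i : ℕ))), hα,
      mul_ne_zero hβ (h1 _), fun i => mul_ne_zero (hκ i) (h1 _), fun i => ?_,
      Or.inl ⟨C_comp, C_mul_X_pow_comp_neg_X _ _, fun i => ?_⟩⟩
    · have h2 : d - (i : ℕ) = d - (i + 1) + 1 := by omega
      simp only [Fin.val_castSucc, Fin.val_succ, h2, mul_add, mul_one, pow_add]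
      linear_combination (-1) ^ (ℓ * (d - (i + 1))) * (-1) ^ ℓ * hrel i
    · beta_reduce
      rw [hf, C_mul_X_pow_comp_neg_X]
  · refine ⟨α * (-1) ^ ℓ, β, fun i => κ i * (-1) ^ (ℓ * (i : ℕ)),
      mul_ne_zero hα (h1 _), hβ, fun i => mul_ne_zero (hκ i) (h1 _), fun i => ?_,
      Or.inr ⟨C_mul_X_pow_comp_neg_X _ _, C_comp, fun i => ?_⟩⟩
    · simp only [Fin.val_castSucc, Fin.val_succ, mul_add, mul_one, pow_add]
      linear_combination (-1) ^ (ℓ * (i : ℕ)) * (-1) ^ ℓ * hrel i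
    · beta_reduce
      rw [hf, C_mul_X_pow_comp_neg_X]

theorem IsDualPencil.moebiusPoly {A : Matrix (Fin 2) (Fin 2) F} (hA : IsStructureMatrix F A)
    (h : IsDualPencil d ℓ c e f) :
    IsDualPencil d ℓ (moebiusPoly ℓ A c) (moebiusPoly ℓ A e)
      (fun i => moebiusPoly (ℓ * d) A (f i)) := by
  obtain ⟨hc, he, hf⟩ := h.natDegree_le
  rcases hA with rfl | rfl | rfl
  · simpa only [moebiusPoly_A₁ hc, moebiusPoly_A₁ he, moebiusPoly_A₁ (hf _)] using h
  · simpa only [moebiusPoly_A₂ hc, moebiusPoly_A₂ he, moebiusPoly_A₂ (hf _)] using h.comp_neg_X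
  · simpa only [moebiusPoly_A₃ hc, moebiusPoly_A₃ he, moebiusPoly_A₃ (hf _)] using h.reflect

theorem isDualPencil_kronecker {a : F} (ha : a ≠ 0) :
    IsDualPencil d ℓ (a • (-1 : F[X])) (a • (X : F[X]) ^ ℓ) (fun i => X ^ (ℓ * (d - (i : ℕ)))) :=
  ⟨-a, a, fun _ => 1, by simpa using ha, ha, by simp, by simp,
    Or.inl ⟨by simp [smul_eq_C_mul], by simp [smul_eq_C_mul], by simp⟩⟩

theorem IsDualPencil.exists_natDegree_eq (h : IsDualPencil d ℓ c e f) :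
    ∃ i, (f i).natDegree = ℓ * d ∧ f i ≠ 0 := by
  obtain ⟨α, β, κ, -, -, hκ, -, ⟨-, -, hf⟩ | ⟨-, -, hf⟩⟩ := h
  · refine ⟨0, ?_⟩
    rw [hf]
    exact ⟨by simp [natDegree_C_mul_X_pow _ _ (hκ 0)], by simp [hκ 0]⟩
  · refine ⟨Fin.last d, ?_⟩
    rw [hf]
    exact ⟨by simp [natDegree_C_mul_X_pow _ _ (hκ (Fin.last d))], by simp [hκ (Fin.last d)]⟩

theorem IsDualPencil.exists_column (h : IsDualPencil d ℓ c e f) (hℓ : 1 ≤ ℓ) (i : Fin d) :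
    ∃ j, (bidiagonal d c e i j).natDegree = ℓ ∧
      ∀ i' ≠ i, (bidiagonal d c e i' j).natDegree < ℓ := by
  obtain ⟨α, β, κ, hα, hβ, -, -, ⟨rfl, rfl, -⟩ | ⟨rfl, rfl, -⟩⟩ := h
  · refine ⟨i.succ, ?_, fun i' hi => ?_⟩
    · simp [bidiagonal, natDegree_C_mul_X_pow _ _ hβ, (Fin.castSucc_lt_succ (i := i)).ne']
    · have h2 : i.succ ≠ i'.succ := fun h => hi (Fin.succ_injective _ h).symm
      simp only [bidiagonal, of_apply, h2, if_false]
      split_ifs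
      · simpa using Nat.lt_of_succ_le hℓ
      · simpa using Nat.lt_of_succ_le hℓ
  · refine ⟨i.castSucc, ?_, fun i' hi => ?_⟩
    · simp [bidiagonal, natDegree_C_mul_X_pow _ _ hα]
    · have h2 : i.castSucc ≠ i'.castSucc := fun h => hi (Fin.castSucc_injective _ h).symm
      simp only [bidiagonal, of_apply, h2, if_false]
      split_ifs
      · simpa using Nat.lt_of_succ_le hℓ
      · simpa using Nat.lt_of_succ_le hℓ

/-- The block column `f ⊗ I_n`. -/
def blockCol {R : Type*} [Zero R] [Mul R] [One R] {m : Type*} (n : Type*) [DecidableEq n]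
    (f : m → R) : Matrix (m × n) n R :=
  Matrix.of fun i j => f i.1 * (1 : Matrix n n R) i.2 j

variable {n : Type*} [Fintype n] [DecidableEq n]

theorem blockCol_mulVec {m : Type*} (f : m → F[X]) (z : n → F[X]) (i : m × n) :
    (blockCol n f *ᵥ z) i = f i.1 * z i.2 := by
  simp [blockCol, mulVec, dotProduct, Matrix.one_apply]

theorem transpose_blockCol_mul_mul_apply {m : Type*} [Fintype m] (f g : m → F[X])
    (M : Matrix (m × n) (m × n) F[X]) (p q : n) :
    ((blockCol n f)ᵀ * M * blockCol n g) p q =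
      ∑ s, ∑ t, f s * M (s, p) (t, q) * g t := by
  simp only [mul_apply, Fintype.sum_prod_type, blockCol, transpose_apply, of_apply,
    Matrix.one_apply, mul_ite, mul_one, mul_zero, ite_mul, zero_mul, Finset.sum_ite_eq',
    Finset.mem_univ, if_true, Finset.sum_mul]
  rw [Finset.sum_comm]

theorem IsDualPencil.exists_isCompletion_kronecker (h : IsDualPencil d ℓ c e f) :
    ∃ Z w, IsCompletion (bidiagonal d c e ⊗ₖ (1 : Matrix n n F[X])) (blockCol n f) Z w := by
  obtain ⟨Z, w, h'⟩ := h.exists_isCompletion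
  exact ⟨_, _, (h'.kronecker_one (n' := n)).submatrix (Equiv.refl _) (Equiv.refl _)
    (Equiv.punitProd n).symm⟩

theorem exists_natDegree_eq_vecDegree {m : Type*} [Fintype m] {z : m → F[X]} (hz : z ≠ 0) :
    ∃ s, z s ≠ 0 ∧ (z s).natDegree = vecDegree z := by
  obtain ⟨t, ht⟩ := Function.ne_iff.1 hz
  obtain ⟨s, -, hs⟩ := Finset.exists_max_image Finset.univ (fun i => (z i).natDegree)
    ⟨t, Finset.mem_univ t⟩
  have hs' : (z s).natDegree = vecDegree z :=
    le_antisymm (natDegree_le_vecDegree z s)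
      (vecDegree_le_iff.2 fun i => hs i (Finset.mem_univ i))
  by_cases h0 : z s = 0
  · refine ⟨t, ht, le_antisymm (natDegree_le_vecDegree z t) ?_⟩
    rw [← hs', h0]
    simp
  · exact ⟨s, h0, hs'⟩

theorem IsDualPencil.vecDegree_blockCol_mulVec (h : IsDualPencil d ℓ c e f) {z : n → F[X]}
    (hz : z ≠ 0) : vecDegree (blockCol n f *ᵥ z) = vecDegree z + d * ℓ := by
  apply le_antisymm
  · rw [vecDegree_le_iff]
    intro i
    rw [blockCol_mulVec, add_comm (vecDegree z), Nat.mul_comm d ℓ]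
    exact natDegree_mul_le.trans (add_le_add (h.natDegree_le.2.2 _) (natDegree_le_vecDegree z _))
  · obtain ⟨i, hi, hi0⟩ := h.exists_natDegree_eq
    obtain ⟨s, hs0, hs⟩ := exists_natDegree_eq_vecDegree hz
    have h1 := natDegree_le_vecDegree (blockCol n f *ᵥ z) (i, s)
    rw [blockCol_mulVec, natDegree_mul hi0 hs0, hi, hs] at h1
    linarith

theorem vecDegree_add_le_of_exists_column {a b : Type*} [Fintype a] [Fintype b]
    {Y : Matrix b a F[X]} (hℓ : 1 ≤ ℓ)
    (hY : ∀ i, ∃ j, (Y i j).natDegree = ℓ ∧ ∀ i' ≠ i, (Y i' j).natDegree < ℓ)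
    {y : b → F[X]} (hy : y ≠ 0) : vecDegree y + ℓ ≤ vecDegree (Yᵀ *ᵥ y) := by
  obtain ⟨i, hi0, hi⟩ := exists_natDegree_eq_vecDegree hy
  obtain ⟨j, hj, hj'⟩ := hY i
  refine le_trans (le_natDegree_of_ne_zero ?_) (natDegree_le_vecDegree _ j)
  have hj0 : Y i j ≠ 0 := by
    intro h
    rw [h, natDegree_zero] at hj
    omega
  have h1 : (Yᵀ *ᵥ y) j = ∑ i', Y i' j * y i' := rfl
  rw [h1, finsetSum_coeff, Finset.sum_eq_single i]
  · rw [← hi, add_comm, ← hj, coeff_mul_degree_add_degree]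
    exact mul_ne_zero (leadingCoeff_ne_zero.2 hj0) (leadingCoeff_ne_zero.2 hi0)
  · intro i' _ hne
    refine coeff_eq_zero_of_natDegree_lt (natDegree_mul_le.trans_lt ?_)
    have h2 := hj' i' hne
    have h3 := natDegree_le_vecDegree y i'
    omega
  · simp

theorem IsDualPencil.vecDegree_add_le (h : IsDualPencil d ℓ c e f) (hℓ : 1 ≤ ℓ)
    {y : Fin d × n → F[X]} (hy : y ≠ 0) :
    vecDegree y + ℓ ≤ vecDegree ((bidiagonal d c e ⊗ₖ (1 : Matrix n n F[X]))ᵀ *ᵥ y) := by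
  refine vecDegree_add_le_of_exists_column hℓ (fun ⟨i, s⟩ => ?_) hy
  obtain ⟨j, hj, hj'⟩ := h.exists_column hℓ i
  refine ⟨(j, s), by simpa using hj, ?_⟩
  rintro ⟨i', s'⟩ hne
  rw [kroneckerMap_apply]
  by_cases hs : s' = s
  · subst hs
    have : i' ≠ i := fun h => hne (by rw [h])
    simpa using hj' i' this
  · simpa [Matrix.one_apply_ne hs] using Nat.lt_of_succ_le hℓ

end DualPencil

/-! ### The sum conditions -/

section SumConditions

open Matrix

variable {F : Type*} [Field F] {ℓ d : ℕ}

theorem coeff_X_pow_mul_of_natDegree_le {q : F[X]} (hq : q.natDegree ≤ ℓ) (g r c : ℕ)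
    (hc : c < ℓ) :
    (X ^ (ℓ * g) * q).coeff (ℓ * r + c) =
      (if g = r then q.coeff c else 0) + if c = 0 ∧ g + 1 = r then q.coeff ℓ else 0 := by
  rw [coeff_X_pow_mul']
  rcases lt_trichotomy g r with h | rfl | h
  · obtain ⟨m, rfl⟩ := Nat.exists_eq_add_of_lt h
    have h1 : ℓ * (g + m + 1) + c = ℓ * g + (ℓ * m + ℓ + c) := by ring
    rw [if_pos (by omega), h1, Nat.add_sub_cancel_left, if_neg (by omega), zero_add]
    split_ifs with h2
    · obtain ⟨rfl, h2⟩ := h2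
      obtain rfl : m = 0 := by omega
      simp
    · refine coeff_eq_zero_of_natDegree_lt (hq.trans_lt ?_)
      rcases Nat.eq_zero_or_pos m with rfl | hm
      · have : c ≠ 0 := fun h => h2 ⟨h, by omega⟩
        omega
      · have := Nat.mul_le_mul_left ℓ hm
        omega
  · simp
  · have h1 := Nat.mul_le_mul_left ℓ (Nat.succ_le_of_lt h)
    rw [Nat.succ_eq_add_one, mul_add, mul_one] at h1
    rw [if_neg (by omega), if_neg (by omega), if_neg (by omega), add_zero]

theorem eq_sum_of_coeff {ι : Type*} (I : Finset ι) {K : ℕ} (hℓ : 1 ≤ ℓ) {p : F[X]}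
    (hp : p.natDegree ≤ (K + 1) * ℓ) {q : ι → F[X]} (hq : ∀ i, (q i).natDegree ≤ ℓ) {g : ι → ℕ}
    (hg : ∀ i, g i ≤ K) (τ : ι → F)
    (h₁ : ∀ r, r ≤ K + 1 → p.coeff (ℓ * r) =
      (∑ i ∈ I, if g i = r then τ i * (q i).coeff 0 else 0) +
        ∑ i ∈ I, if g i + 1 = r then τ i * (q i).coeff ℓ else 0)
    (h₂ : ∀ r, r ≤ K → ∀ c, 1 ≤ c → c ≤ ℓ - 1 → p.coeff (ℓ * r + c) =
      ∑ i ∈ I, if g i = r then τ i * (q i).coeff c else 0) :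
    p = ∑ i ∈ I, C (τ i) * (X ^ (ℓ * g i) * q i) := by
  ext N
  obtain ⟨r, c, hc, rfl⟩ : ∃ r c, c < ℓ ∧ N = ℓ * r + c :=
    ⟨N / ℓ, N % ℓ, Nat.mod_lt _ hℓ, (Nat.div_add_mod N ℓ).symm⟩
  simp only [finsetSum_coeff, coeff_C_mul, coeff_X_pow_mul_of_natDegree_le (hq _) _ _ _ hc, mul_add,
    Finset.sum_add_distrib, mul_ite, mul_zero]
  rcases Nat.eq_zero_or_pos c with rfl | hc0
  · by_cases hr : r ≤ K + 1
    · simpa using h₁ r hr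
    · rw [coeff_eq_zero_of_natDegree_lt, Finset.sum_eq_zero, Finset.sum_eq_zero, add_zero]
      · intro i _
        have := hg i
        rw [if_neg (by omega)]
      · intro i _
        have := hg i
        rw [if_neg (by omega)]
      · have h1 := Nat.mul_le_mul_left ℓ (show K + 2 ≤ r by omega)
        nlinarith
  · simp only [hc0.ne', false_and, if_false, Finset.sum_const_zero, add_zero]
    by_cases hr : r ≤ K
    · exact h₂ r hr c hc0 (by omega)
    · rw [coeff_eq_zero_of_natDegree_lt, Finset.sum_eq_zero]
      · intro i _
        have := hg i
        rw [if_neg (by omega)]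
      · have h1 := Nat.mul_le_mul_left ℓ (show K + 1 ≤ r by omega)
        nlinarith

variable {n : ℕ} {P : Matrix (Fin n) (Fin n) F[X]}
  {M : Matrix (Fin (d + 1) × Fin n) (Fin (d + 1) × Fin n) F[X]}

theorem eq_sum_of_coeffMatrix (hℓ : 1 ≤ ℓ) (hP : HasGrade ((2 * d + 1) * ℓ) P)
    (hM : HasGrade ℓ M) {g : Fin (d + 1) → Fin (d + 1) → ℕ} (hg : ∀ s t, g s t ≤ 2 * d)
    {τ : Fin (d + 1) → F}
    (h₁ : ∀ r : ℕ, r ≤ 2 * d + 1 → coeffMatrix P (ℓ * r) =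
      (∑ s, ∑ t, if g s t = r then τ s • block M 0 s t else 0) +
        ∑ s, ∑ t, if g s t + 1 = r then τ s • block M ℓ s t else 0)
    (h₂ : ∀ r : ℕ, r ≤ 2 * d → ∀ c : ℕ, 1 ≤ c → c ≤ ℓ - 1 → coeffMatrix P (ℓ * r + c) =
      ∑ s, ∑ t, if g s t = r then τ s • block M c s t else 0) (p q : Fin n) :
    P p q = ∑ s, ∑ t, C (τ s) * (X ^ (ℓ * g s t) * M (s, p) (t, q)) := by
  have key := eq_sum_of_coeff (ι := Fin (d + 1) × Fin (d + 1)) (K := 2 * d) (p := P p q)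
    Finset.univ hℓ (hP p q) (q := fun i => M (i.1, p) (i.2, q)) (fun i => hM _ _)
    (g := fun i => g i.1 i.2) (fun i => hg _ _) (fun i => τ i.1)
  rw [Fintype.sum_prod_type] at key
  refine key (fun r hr => ?_) (fun r hr c hc hc' => ?_)
  · have h := congrFun (congrFun (h₁ r hr) p) q
    simp only [Matrix.add_apply, Matrix.sum_apply, coeffMatrix, map_apply, apply_ite (fun B :
      Matrix (Fin n) (Fin n) F => B p q), Matrix.smul_apply, block, of_apply,
      Matrix.zero_apply, smul_eq_mul] at h
    rw [h, Fintype.sum_prod_type, Fintype.sum_prod_type]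
  · have h := congrFun (congrFun (h₂ r hr c hc hc') p) q
    simp only [Matrix.sum_apply, coeffMatrix, map_apply, apply_ite (fun B :
      Matrix (Fin n) (Fin n) F => B p q), Matrix.smul_apply, block, of_apply,
      Matrix.zero_apply, smul_eq_mul] at h
    rw [h, Fintype.sum_prod_type]

theorem AS.eq_transpose_blockCol_mul_mul (h : AS ℓ d P M) (hℓ : 1 ≤ ℓ)
    (hP : HasGrade ((2 * d + 1) * ℓ) P) (hM : HasGrade ℓ M) :
    P = (blockCol (Fin n) fun s : Fin (d + 1) => (X ^ (ℓ * (d - (s : ℕ))) : F[X]))ᵀ * M *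
      blockCol (Fin n) fun t : Fin (d + 1) => (X ^ (ℓ * (d - (t : ℕ))) : F[X]) := by
  ext1 p q
  have h1 : ∀ (s t : Fin (d + 1)) (r : ℕ), (((s : ℤ) + 1) + ((t : ℤ) + 1) = 2 * d + 2 - r) ↔
      (d - (s : ℕ)) + (d - (t : ℕ)) = r := fun s t r => by omega
  have h2 : ∀ (s t : Fin (d + 1)) (r : ℕ), (((s : ℤ) + 1) + ((t : ℤ) + 1) = 2 * d + 3 - r) ↔
      (d - (s : ℕ)) + (d - (t : ℕ)) + 1 = r := fun s t r => by omega
  simp only [AS, h1, h2] at h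
  rw [transpose_blockCol_mul_mul_apply, eq_sum_of_coeffMatrix hℓ hP hM
    (g := fun s t => (d - (s : ℕ)) + (d - (t : ℕ))) (fun s t => by omega) (τ := fun _ => 1)
    (by simpa using h.1) (by simpa using h.2)]
  refine Finset.sum_congr rfl fun s _ => Finset.sum_congr rfl fun t _ => ?_
  rw [C_1, mul_add, pow_add]
  ring

theorem ASS.eq_transpose_blockCol_mul_mul (h : ASS ℓ d P M) (hℓ : 1 ≤ ℓ)
    (hP : HasGrade ((2 * d + 1) * ℓ) P) (hM : HasGrade ℓ M) :
    P = (blockCol (Fin n) fun s : Fin (d + 1) =>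
        ((-1) ^ (d - (s : ℕ)) * X ^ (ℓ * (d - (s : ℕ))) : F[X]))ᵀ * M *
      blockCol (Fin n) fun t : Fin (d + 1) => (X ^ (ℓ * (d - (t : ℕ))) : F[X]) := by
  ext1 p q
  have h1 : ∀ (s t : Fin (d + 1)) (r : ℕ), (((s : ℤ) + 1) + ((t : ℤ) + 1) = 2 * d + 2 - r) ↔
      (d - (s : ℕ)) + (d - (t : ℕ)) = r := fun s t r => by omega
  have h2 : ∀ (s t : Fin (d + 1)) (r : ℕ), (((s : ℤ) + 1) + ((t : ℤ) + 1) = 2 * d + 3 - r) ↔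
      (d - (s : ℕ)) + (d - (t : ℕ)) + 1 = r := fun s t r => by omega
  simp only [ASS, h1, h2] at h
  rw [transpose_blockCol_mul_mul_apply, eq_sum_of_coeffMatrix hℓ hP hM
    (g := fun s t => (d - (s : ℕ)) + (d - (t : ℕ))) (fun s t => by omega)
    (τ := fun s => (-1) ^ (d - (s : ℕ))) h.1 h.2]
  refine Finset.sum_congr rfl fun s _ => Finset.sum_congr rfl fun t _ => ?_
  rw [C_pow, C_neg, C_1, mul_add, pow_add]
  ring

theorem DS.eq_transpose_blockCol_mul_mul (h : DS ℓ d P M) (hℓ : 1 ≤ ℓ)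
    (hP : HasGrade ((2 * d + 1) * ℓ) P) (hM : HasGrade ℓ M) :
    P = (blockCol (Fin n) fun s : Fin (d + 1) => (X ^ (ℓ * (s : ℕ)) : F[X]))ᵀ * M *
      blockCol (Fin n) fun t : Fin (d + 1) => (X ^ (ℓ * (d - (t : ℕ))) : F[X]) := by
  ext1 p q
  have h1 : ∀ (s t : Fin (d + 1)) (r : ℕ), (((s : ℤ) + 1) - ((t : ℤ) + 1) = r - d) ↔
      s + (d - (t : ℕ)) = r := fun s t r => by omega
  have h2 : ∀ (s t : Fin (d + 1)) (r : ℕ), (((s : ℤ) + 1) - ((t : ℤ) + 1) = r - d - 1) ↔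
      s + (d - (t : ℕ)) + 1 = r := fun s t r => by omega
  simp only [DS, h1, h2] at h
  rw [transpose_blockCol_mul_mul_apply, eq_sum_of_coeffMatrix hℓ hP hM
    (g := fun s t => s + (d - (t : ℕ))) (fun s t => by omega) (τ := fun _ => 1)
    (by simpa using h.1) (by simpa using h.2)]
  refine Finset.sum_congr rfl fun s _ => Finset.sum_congr rfl fun t _ => ?_
  rw [C_1, mul_add, pow_add]
  ring

end SumConditions

/-! ### Structured block-Kronecker matrix polynomials -/

section BlockKronecker

open Matrix

variable {F : Type*} [Field F] {d ℓ : ℕ}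

theorem kroneckerPencilPow_eq_bidiagonal (d ℓ : ℕ) :
    kroneckerPencilPow F d ℓ = bidiagonal d (-1) (X ^ ℓ) := by
  ext1 i j
  simp only [kroneckerPencilPow, kroneckerPencil, bidiagonal, map_apply, of_apply]
  split_ifs <;> simp

theorem bidiagonal_map {R : Type*} [CommRing R] {d : ℕ} {c e : R} (φ : R → R) (h0 : φ 0 = 0) :
    (bidiagonal d c e).map φ = bidiagonal d (φ c) (φ e) := by
  ext1 i j
  simp only [bidiagonal, map_apply, of_apply]
  split_ifs <;> simp [h0]

theorem smul_bidiagonal (d : ℕ) (ε : F) (c e : F[X]) :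
    ε • bidiagonal d c e = bidiagonal d (ε • c) (ε • e) := by
  ext1 i j
  simp only [bidiagonal, Matrix.smul_apply, of_apply]
  split_ifs <;> simp

theorem kronecker_one_map {R : Type*} [CommRing R] {a b n : Type*} [DecidableEq n]
    (B : Matrix a b R) (φ : R → R) (h0 : φ 0 = 0) :
    (B ⊗ₖ (1 : Matrix n n R)).map φ = B.map φ ⊗ₖ (1 : Matrix n n R) := by
  ext ⟨i, s⟩ ⟨j, t⟩
  by_cases h : s = t <;> simp [h, h0]

theorem hasGrade_bidiagonal_kronecker_one {n : Type*} [DecidableEq n] {c e : F[X]}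
    (hc : c.natDegree ≤ ℓ) (he : e.natDegree ≤ ℓ) :
    HasGrade ℓ (bidiagonal d c e ⊗ₖ (1 : Matrix n n F[X])) := by
  rintro ⟨i, s⟩ ⟨j, t⟩
  by_cases h : s = t
  · simp only [kroneckerMap_apply, h, Matrix.one_apply_eq, mul_one, bidiagonal, of_apply]
    split_ifs <;> simp [hc, he]
  · simp [h]

theorem hasGrade_fromBlocks {a b a' b' : Type*} {A : Matrix a a' F[X]} {B : Matrix a b' F[X]}
    {C : Matrix b a' F[X]} {D : Matrix b b' F[X]} (hA : HasGrade ℓ A) (hB : HasGrade ℓ B)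
    (hC : HasGrade ℓ C) (hD : HasGrade ℓ D) : HasGrade ℓ (fromBlocks A B C D) := by
  rintro (i | i) (j | j)
  exacts [hA i j, hB i j, hC i j, hD i j]

theorem HasGrade.transpose {m n : Type*} {P : Matrix m n F[X]} (h : HasGrade ℓ P) :
    HasGrade ℓ Pᵀ := fun i j => h j i

theorem HasGrade.rev {m n : Type*} {P : Matrix m n F[X]} (h : HasGrade ℓ P) :
    HasGrade ℓ (rev ℓ P) := fun i j => natDegree_reflect_le_of_le (h i j)

theorem rev_transpose_blockCol_mul_mul {m n : Type*} [Fintype m] [Fintype n] [DecidableEq n]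
    {f g : m → F[X]} {M : Matrix (m × n) (m × n) F[X]} {D : ℕ} (hf : ∀ i, (f i).natDegree ≤ D)
    (hg : ∀ i, (g i).natDegree ≤ D) (hM : HasGrade ℓ M) :
    rev (D + ℓ + D) ((blockCol n f)ᵀ * M * blockCol n g) =
      (blockCol n fun i => reflect D (f i))ᵀ * rev ℓ M * blockCol n fun i => reflect D (g i) := by
  ext1 p q
  have h : ∀ (s : Finset m) (h : m → F[X]), reflect (D + ℓ + D) (∑ j ∈ s, h j) =
      ∑ j ∈ s, reflect (D + ℓ + D) (h j) := fun s h =>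
    map_sum (AddMonoidHom.mk' (reflect (D + ℓ + D)) (fun f g => reflect_add f g _)) h s
  simp only [rev, map_apply, transpose_blockCol_mul_mul_apply, h]
  refine Finset.sum_congr rfl fun s _ => Finset.sum_congr rfl fun t _ => ?_
  rw [reflect_mul _ _ (natDegree_mul_le.trans (add_le_add (hf s) (hM _ _))) (hg t),
    reflect_mul _ _ (hf s) (hM _ _)]

variable {n : ℕ} {c e c' e' : F[X]} {f f' : Fin (d + 1) → F[X]}
  {M : Matrix (Fin (d + 1) × Fin n) (Fin (d + 1) × Fin n) F[X]}

theorem isEllification_of_isDualPencil (hX : IsDualPencil d ℓ c e f)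
    (hY : IsDualPencil d ℓ c' e' f') (hM : HasGrade ℓ M) {k : ℕ}
    (hP : HasGrade k ((blockCol (Fin n) f')ᵀ * M * blockCol (Fin n) f)) :
    IsEllification ℓ k
      (fromBlocks M (bidiagonal d c' e' ⊗ₖ (1 : Matrix (Fin n) (Fin n) F[X]))ᵀ
        (bidiagonal d c e ⊗ₖ (1 : Matrix (Fin n) (Fin n) F[X])) 0)
      ((blockCol (Fin n) f')ᵀ * M * blockCol (Fin n) f) := by
  obtain ⟨Z, w, h⟩ := hX.exists_isCompletion_kronecker (n := Fin n)
  obtain ⟨Z', w', h'⟩ := hY.exists_isCompletion_kronecker (n := Fin n)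
  refine isEllification_of_isCompletion (Fintype.equivOfCardEq (by simp; ring)) h h'
    (hasGrade_fromBlocks hM ?_ ?_ ?_) hP
  · exact (hasGrade_bidiagonal_kronecker_one hY.natDegree_le.1 hY.natDegree_le.2.1).transpose
  · exact hasGrade_bidiagonal_kronecker_one hX.natDegree_le.1 hX.natDegree_le.2.1
  · intro i j
    simp

theorem isStrongEllification_of_isDualPencil (hX : IsDualPencil d ℓ c e f)
    (hY : IsDualPencil d ℓ c' e' f') (hM : HasGrade ℓ M)
    (hP : HasGrade (ℓ * d + ℓ + ℓ * d) ((blockCol (Fin n) f')ᵀ * M * blockCol (Fin n) f)) :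
    IsStrongEllification ℓ (ℓ * d + ℓ + ℓ * d)
      (fromBlocks M (bidiagonal d c' e' ⊗ₖ (1 : Matrix (Fin n) (Fin n) F[X]))ᵀ
        (bidiagonal d c e ⊗ₖ (1 : Matrix (Fin n) (Fin n) F[X])) 0)
      ((blockCol (Fin n) f')ᵀ * M * blockCol (Fin n) f) := by
  refine ⟨isEllification_of_isDualPencil hX hY hM hP, ?_⟩
  have hrevP := hP.rev
  rw [rev_transpose_blockCol_mul_mul hY.natDegree_le.2.2 hX.natDegree_le.2.2 hM] at hrevP ⊢
  convert isEllification_of_isDualPencil hX.reflect hY.reflect hM.rev hrevP using 1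
  have h0 : reflect ℓ (0 : F[X]) = 0 := reflect_zero
  simp only [rev, fromBlocks_map, transpose_map, kronecker_one_map _ (reflect ℓ) h0,
    bidiagonal_map (reflect ℓ) h0]
  congr 1

theorem areRightMinimalIndices_iff_of_isDualPencil (hℓ : 1 ≤ ℓ) (hX : IsDualPencil d ℓ c e f)
    (hY : IsDualPencil d ℓ c' e' f') (hM : HasGrade ℓ M) {p : ℕ} (δ : Fin p → ℕ) :
    AreRightMinimalIndices
      (fromBlocks M (bidiagonal d c' e' ⊗ₖ (1 : Matrix (Fin n) (Fin n) F[X]))ᵀ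
        (bidiagonal d c e ⊗ₖ (1 : Matrix (Fin n) (Fin n) F[X])) 0) δ ↔
      ∃ η : Fin p → ℕ,
        AreRightMinimalIndices ((blockCol (Fin n) f')ᵀ * M * blockCol (Fin n) f) η ∧
          ∀ i, δ i = η i + d * ℓ := by
  obtain ⟨Z, w, h⟩ := hX.exists_isCompletion_kronecker (n := Fin n)
  obtain ⟨Z', w', h'⟩ := hY.exists_isCompletion_kronecker (n := Fin n)
  exact areRightMinimalIndices_iff_of_isCompletion h h' hM
    (fun z hz => hX.vecDegree_blockCol_mulVec hz) (fun y hy => hY.vecDegree_add_le hℓ hy) δ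

theorem areLeftMinimalIndices_iff_of_isDualPencil (hℓ : 1 ≤ ℓ) (hX : IsDualPencil d ℓ c e f)
    (hY : IsDualPencil d ℓ c' e' f') (hM : HasGrade ℓ M) {p : ℕ} (δ : Fin p → ℕ) :
    AreLeftMinimalIndices
      (fromBlocks M (bidiagonal d c' e' ⊗ₖ (1 : Matrix (Fin n) (Fin n) F[X]))ᵀ
        (bidiagonal d c e ⊗ₖ (1 : Matrix (Fin n) (Fin n) F[X])) 0) δ ↔
      ∃ η : Fin p → ℕ,
        AreLeftMinimalIndices ((blockCol (Fin n) f')ᵀ * M * blockCol (Fin n) f) η ∧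
          ∀ i, δ i = η i + d * ℓ := by
  have h := areRightMinimalIndices_iff_of_isDualPencil hℓ hY hX hM.transpose δ
  unfold AreLeftMinimalIndices leftNullspace
  rw [fromBlocks_transpose, transpose_transpose, transpose_zero, transpose_mul, transpose_mul,
    transpose_transpose, ← Matrix.mul_assoc]
  exact h

/-! ### The Moebius structure -/

variable {A : Matrix (Fin 2) (Fin 2) F} {σ : F →+* F} {ε : F}

theorem hasGrade_structuredPart (hA : IsStructureMatrix F A) {m : Type*} {M : Matrix m m F[X]}
    (hM : HasGrade ℓ M) : HasGrade ℓ (structuredPart σ ℓ A ε M) := by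
  intro i j
  refine (natDegree_smul_le _ _).trans ((natDegree_add_le_of_le (hM i j) ?_).trans_eq (max_self ℓ))
  exact natDegree_map_le.trans (hA.natDegree_le ((natDegree_smul_le _ _).trans (hM j i)))

theorem structuredPart_apply {m : Type*} (M : Matrix m m F[X]) (i j : m) :
    structuredPart σ ℓ A ε M i j =
      (2 : F)⁻¹ • (M i j + (moebiusPoly ℓ A (ε • M j i)).map σ) := rfl

theorem isMoebiusStructured_iff {m : Type*} {M : Matrix m m F[X]} :
    IsMoebiusStructured σ ℓ A ε M ↔
      ∀ i j, moebiusPoly ℓ A (ε • M i j) = (M j i).map σ :=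
  ⟨fun h i j => congrFun (congrFun h i) j, fun h => Matrix.ext h⟩

theorem map_smul_ringHom (a : F) (p : F[X]) : (a • p).map σ = σ a • p.map σ := by
  rw [smul_eq_C_mul, Polynomial.map_mul, map_C, ← smul_eq_C_mul]

theorem isMoebiusStructured_structuredPart (hA : IsStructureMatrix F A)
    (hσ : ∀ x, σ (σ x) = x) (hε : ε = 1 ∨ ε = -1) {m : Type*} {M : Matrix m m F[X]}
    (hM : HasGrade ℓ M) : IsMoebiusStructured σ ℓ A ε (structuredPart σ ℓ A ε M) := by
  have hσε : σ ε = ε := by rcases hε with rfl | rfl <;> simp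
  have hεε : ε * ε = 1 := by rcases hε with rfl | rfl <;> simp
  have hσσ : ∀ p : F[X], (p.map σ).map σ = p := fun p => by
    ext i
    simp [hσ]
  refine isMoebiusStructured_iff.2 fun i j => ?_
  rw [structuredPart_apply, structuredPart_apply, moebiusPoly_smul, moebiusPoly_smul,
    moebiusPoly_add, ← hA.map_moebiusPoly,
    hA.moebiusPoly_moebiusPoly ((natDegree_smul_le _ _).trans (hM j i)), map_smul_ringHom,
    map_smul_ringHom, Polynomial.map_add, hσσ, hσε, moebiusPoly_smul, map_inv₀, map_ofNat,
    smul_comm ε, smul_add ε, smul_smul ε ε, hεε, one_smul, add_comm]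

theorem eq_transpose_blockCol_mul_structuredPart_mul (h2 : (2 : F) ≠ 0)
    (hA : IsStructureMatrix F A) (hσ : ∀ x, σ (σ x) = x) {m n : Type*} [Fintype m] [Fintype n]
    [DecidableEq n] {f : m → F[X]} {D : ℕ} (hf : ∀ i, (f i).natDegree ≤ D)
    (hfσ : ∀ i, (f i).map σ = f i) {M : Matrix (m × n) (m × n) F[X]} (hM : HasGrade ℓ M)
    {P : Matrix n n F[X]} (hP : IsMoebiusStructured σ (D + ℓ + D) A ε P)
    (hPM : P = (blockCol n fun i => moebiusPoly D A (f i))ᵀ * M * blockCol n f) :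
    P = (blockCol n fun i => moebiusPoly D A (f i))ᵀ * structuredPart σ ℓ A ε M *
      blockCol n f := by
  have hσσ : ∀ p : F[X], (p.map σ).map σ = p := fun p => by
    ext i
    simp [hσ]
  have hPM' : ∀ p q, P p q = ∑ s, ∑ t, moebiusPoly D A (f s) * M (s, p) (t, q) * f t :=
    fun p q => by
      conv_lhs => rw [hPM]
      exact transpose_blockCol_mul_mul_apply _ _ _ _ _
  have hstar : ∀ p q, P p q = ∑ s, ∑ t, moebiusPoly D A (f s) *
      (moebiusPoly ℓ A (ε • M (t, q) (s, p))).map σ * f t := by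
    intro p q
    have h := isMoebiusStructured_iff.1 hP q p
    have hmul : ∀ s t, moebiusPoly (D + ℓ + D) A
        (ε • (moebiusPoly D A (f s) * M (s, q) (t, p) * f t)) =
        f s * moebiusPoly ℓ A (ε • M (s, q) (t, p)) * moebiusPoly D A (f t) := by
      intro s t
      have hT := hA.natDegree_le (hf s)
      rw [moebiusPoly_smul, hA.moebiusPoly_mul (natDegree_mul_le.trans (add_le_add hT (hM _ _)))
        (hf t), hA.moebiusPoly_mul hT (hM _ _), hA.moebiusPoly_moebiusPoly (hf s),
        moebiusPoly_smul, mul_smul_comm, smul_mul_assoc]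
    rw [hPM' q p] at h
    simp only [Finset.smul_sum, moebiusPoly_sum, hmul] at h
    rw [← hσσ (P p q), ← h]
    simp only [Polynomial.map_sum, Polynomial.map_mul, hA.map_moebiusPoly, hfσ]
    rw [Finset.sum_comm]
    refine Finset.sum_congr rfl fun s _ => Finset.sum_congr rfl fun t _ => ?_
    ring
  ext1 p q
  rw [transpose_blockCol_mul_mul_apply]
  have h4 : P p q = (2 : F)⁻¹ • (P p q + P p q) := by
    rw [← two_smul F (P p q), smul_smul, inv_mul_cancel₀ h2, one_smul]
  rw [h4]
  conv_lhs =>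
    enter [2]
    congr
    · rw [hPM' p q]
    · rw [hstar p q]
  simp only [← Finset.sum_add_distrib, Finset.smul_sum, structuredPart_apply]
  refine Finset.sum_congr rfl fun s _ => Finset.sum_congr rfl fun t _ => ?_
  rw [mul_smul_comm, smul_mul_assoc]
  congr 1
  ring

theorem moebius_smul_kroneckerPencilPow (d ℓ : ℕ) (A : Matrix (Fin 2) (Fin 2) F) (ε : F) :
    moebius ℓ A (ε • kroneckerPencilPow F d ℓ) =
      bidiagonal d (moebiusPoly ℓ A (ε • (-1 : F[X]))) (moebiusPoly ℓ A (ε • (X : F[X]) ^ ℓ)) := by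
  rw [kroneckerPencilPow_eq_bidiagonal, smul_bidiagonal, moebius_eq_map,
    bidiagonal_map _ (moebiusPoly_zero ℓ A)]

theorem isMoebiusStructured_blockKronecker (hA : IsStructureMatrix F A)
    (hε : ε = 1 ∨ ε = -1) (hM : IsMoebiusStructured σ ℓ A ε M) :
    IsMoebiusStructured σ ℓ A ε (blockKronecker d ℓ n A ε M) := by
  have hεε : ε * ε = 1 := by rcases hε with rfl | rfl <;> simp
  have hσε : σ ε = ε := by rcases hε with rfl | rfl <;> simp
  have hK : ∀ i j, (kroneckerPencilPow F d ℓ i j).natDegree ≤ ℓ ∧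
      (kroneckerPencilPow F d ℓ i j).map σ = kroneckerPencilPow F d ℓ i j := by
    intro i j
    rw [kroneckerPencilPow_eq_bidiagonal]
    simp only [bidiagonal, of_apply]
    split_ifs <;> simp
  rw [isMoebiusStructured_iff] at hM ⊢
  rintro (i | ⟨i, s⟩) (j | ⟨j, t⟩)
  · exact hM i j
  · obtain ⟨i, s⟩ := i
    simp only [blockKronecker, fromBlocks_apply₁₂, fromBlocks_apply₂₁, kroneckerMap_apply,
      transpose_apply, moebius_eq_map, map_apply, Matrix.smul_apply]
    by_cases hst : s = t
    · subst hst
      rw [Matrix.one_apply_eq, mul_one, mul_one, (hK j i).2, moebiusPoly_smul, moebiusPoly_smul,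
        moebiusPoly_smul, hA.moebiusPoly_moebiusPoly (hK j i).1, smul_smul, hεε, one_smul]
    · simp [Matrix.one_apply_ne hst, Matrix.one_apply_ne (Ne.symm hst), moebiusPoly_zero]
  · obtain ⟨j, t⟩ := j
    simp only [blockKronecker, fromBlocks_apply₁₂, fromBlocks_apply₂₁, kroneckerMap_apply,
      transpose_apply, moebius_eq_map, map_apply, Matrix.smul_apply]
    by_cases hst : s = t
    · subst hst
      rw [Matrix.one_apply_eq, mul_one, mul_one, hA.map_moebiusPoly, map_smul_ringHom, (hK i j).2,
        hσε]
    · simp [Matrix.one_apply_ne hst, Matrix.one_apply_ne (Ne.symm hst), moebiusPoly_zero]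
  · simp [blockKronecker, moebiusPoly_zero]

theorem eq_transpose_blockCol_moebiusPoly_mul_mul (hℓ : 1 ≤ ℓ) {P : Matrix (Fin n) (Fin n) F[X]}
    (hP : HasGrade ((2 * d + 1) * ℓ) P) (hM : HasGrade ℓ M)
    (h : (A = A₁ F ∧ AS ℓ d P M) ∨ (A = A₂ F ∧ Even ℓ ∧ AS ℓ d P M) ∨
      (A = A₂ F ∧ Odd ℓ ∧ ASS ℓ d P M) ∨ (A = A₃ F ∧ DS ℓ d P M)) :
    P = (blockCol (Fin n) fun s : Fin (d + 1) =>
        moebiusPoly (ℓ * d) A ((X : F[X]) ^ (ℓ * (d - (s : ℕ)))))ᵀ * M *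
      blockCol (Fin n) fun t : Fin (d + 1) => (X : F[X]) ^ (ℓ * (d - (t : ℕ))) := by
  have hle : ∀ s : Fin (d + 1), ((X : F[X]) ^ (ℓ * (d - (s : ℕ)))).natDegree ≤ ℓ * d := fun s =>
    (natDegree_X_pow_le _).trans (Nat.mul_le_mul_left _ (Nat.sub_le _ _))
  rcases h with ⟨rfl, h⟩ | ⟨rfl, hpar, h⟩ | ⟨rfl, hpar, h⟩ | ⟨rfl, h⟩
  · simp only [moebiusPoly_A₁ (hle _)]
    exact h.eq_transpose_blockCol_mul_mul hℓ hP hM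
  · simp only [moebiusPoly_A₂ (hle _), X_pow_comp, (hpar.mul_right _).neg_pow]
    exact h.eq_transpose_blockCol_mul_mul hℓ hP hM
  · have hX : ∀ j, (-X : F[X]) ^ (ℓ * j) = (-1) ^ j * X ^ (ℓ * j) := fun j => by
      rw [neg_pow, pow_mul, hpar.neg_one_pow]
    simp only [moebiusPoly_A₂ (hle _), X_pow_comp, hX]
    exact h.eq_transpose_blockCol_mul_mul hℓ hP hM
  · have hX : ∀ s : Fin (d + 1), reflect (ℓ * d) ((X : F[X]) ^ (ℓ * (d - (s : ℕ)))) =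
        X ^ (ℓ * (s : ℕ)) := fun s => by
      rw [reflect_monomial, revAt_le (Nat.mul_le_mul_left _ (Nat.sub_le _ _)), ← Nat.mul_sub,
        Nat.sub_sub_self s.is_le]
    simp only [moebiusPoly_A₃ (hle _), hX]
    exact h.eq_transpose_blockCol_mul_mul hℓ hP hM

end BlockKronecker

end

end MatPoly

theorem theorem4p7 {F : Type*} [Field F] (h2 : (2 : F) ≠ 0)
    (σ : F →+* F) (hσ : ∀ x, σ (σ x) = x)
    (n d ℓ k : ℕ) (hℓ : 1 ≤ ℓ) (hk : k = (2 * d + 1) * ℓ)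
    (A : Matrix (Fin 2) (Fin 2) F) (ε : F) (hε : ε = 1 ∨ ε = -1)
    (P : Matrix (Fin n) (Fin n) F[X]) (hPk : MatPoly.HasGrade k P)
    (hP : MatPoly.IsMoebiusStructured σ k A ε P)
    (M : Matrix (Fin (d + 1) × Fin n) (Fin (d + 1) × Fin n) F[X]) (hM : MatPoly.HasGrade ℓ M)
    (hcond :
      (A = MatPoly.A₁ F ∧ MatPoly.AS ℓ d P M) ∨
      (A = MatPoly.A₂ F ∧ Even ℓ ∧ MatPoly.AS ℓ d P M) ∨
      (A = MatPoly.A₂ F ∧ Odd ℓ ∧ MatPoly.ASS ℓ d P M) ∨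
      (A = MatPoly.A₃ F ∧ MatPoly.DS ℓ d P M))
    (L : Matrix ((Fin (d + 1) × Fin n) ⊕ (Fin d × Fin n))
      ((Fin (d + 1) × Fin n) ⊕ (Fin d × Fin n)) F[X])
    (hL : L = MatPoly.blockKronecker d ℓ n A ε (MatPoly.structuredPart σ ℓ A ε M)) :
    MatPoly.IsMoebiusStructured σ ℓ A ε L ∧
    MatPoly.IsStructuredBlockKronecker σ d ℓ n A ε L ∧
    MatPoly.IsStrongEllification ℓ k L P ∧
    (∀ (p : ℕ) (δ : Fin p → ℕ), MatPoly.AreRightMinimalIndices L δ ↔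
      ∃ η : Fin p → ℕ, MatPoly.AreRightMinimalIndices P η ∧ ∀ i, δ i = η i + d * ℓ) ∧
    (∀ (p : ℕ) (δ : Fin p → ℕ), MatPoly.AreLeftMinimalIndices L δ ↔
      ∃ η : Fin p → ℕ, MatPoly.AreLeftMinimalIndices P η ∧ ∀ i, δ i = η i + d * ℓ) := by
  have hA : MatPoly.IsStructureMatrix F A := by
    rcases hcond with ⟨h, -⟩ | ⟨h, -⟩ | ⟨h, -⟩ | ⟨h, -⟩ <;> simp [MatPoly.IsStructureMatrix, h]
  have hε0 : ε ≠ 0 := by rcases hε with rfl | rfl <;> simp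
  have hk' : k = ℓ * d + ℓ + ℓ * d := by rw [hk]; ring
  have hrep := MatPoly.eq_transpose_blockCol_moebiusPoly_mul_mul hℓ (hk ▸ hPk) hM hcond
  rw [hk'] at hPk hP
  have hX := MatPoly.isDualPencil_kronecker (d := d) (ℓ := ℓ) (one_ne_zero (α := F))
  rw [one_smul, one_smul] at hX
  have hY := (MatPoly.isDualPencil_kronecker (d := d) (ℓ := ℓ) hε0).moebiusPoly hA
  have hrep' := MatPoly.eq_transpose_blockCol_mul_structuredPart_mul h2 hA hσ hX.natDegree_le.2.2
    (fun i => by simp) hM hP hrep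
  have hM' := MatPoly.hasGrade_structuredPart (σ := σ) (ε := ε) hA hM
  have hS := MatPoly.isMoebiusStructured_structuredPart hA hσ hε hM
  have hLS : MatPoly.IsMoebiusStructured σ ℓ A ε L :=
    hL ▸ MatPoly.isMoebiusStructured_blockKronecker hA hε hS
  refine ⟨hLS, ⟨_, hM', hS, hL⟩, ?_⟩
  rw [MatPoly.blockKronecker, MatPoly.moebius_smul_kroneckerPencilPow,
    MatPoly.kroneckerPencilPow_eq_bidiagonal, ← Matrix.transpose_one (n := Fin n),
    Matrix.kroneckerMap_transpose, Matrix.transpose_one] at hL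
  rw [hk', hL]
  generalize MatPoly.structuredPart σ ℓ A ε M = N at *
  subst hrep'
  exact ⟨MatPoly.isStrongEllification_of_isDualPencil hX hY hM' hPk,
    fun p δ => MatPoly.areRightMinimalIndices_iff_of_isDualPencil hℓ hX hY hM' δ,
    fun p δ => MatPoly.areLeftMinimalIndices_iff_of_isDualPencil hℓ hX hY hM' δ⟩
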